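/- Let $k$ be a field of characteristic zero and let $q \in k^{\times}$ satisfy $q^n \neq 1$ for all $n \geq 1$. Let $k_q(y)((x))$ be the division ring of Laurent series $\sum_{i \geq n} a_i x^i$ ($n \in \mathbb{Z}$, $a_i \in k(y)$), with multiplication determined by $xy = qyx$, and let $D = k_q(x,y) \subset k_q(y)((x))$ be the division ring of fractions of the quantum plane $k_q[x,y]$, i.e. of the $k$-subalgebra generated by $x$ and $y$. For $0 \neq z \in k_q(y)((x))$ with $zDz^{-1} \subseteq D$, let $c_z : D \to D$, $r \mapsto zrz^{-1}$, be the resulting conjugation map, a $k$-algebra endomorphism of $D$. Then: (i) $D$ admits bijective conjugation maps $c_z$ with $z \in k_q(y)((x)) \setminus D$, of each of the following two kinds. (a) Some of these satisfy $z^n \in D$ for some $n \geq 1$. Namely, there is an automorphism $\varphi$ of $D$ with $\varphi^2 = \mathrm{id}$, $\varphi(x) = (y^{-1} - q^{-1}y)x^{-1}$ and $\varphi(y) = -y^{-1}$, and there are a $k$-algebra isomorphism $\iota : D \to D^{\varphi}$ onto the fixed ring $D^{\varphi} = \{r \in D : \varphi(r) = r\}$ and an element $z \in k_q(y)((x)) \setminus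 D$ with $z^2 \in D$, such that $c_z$ is a bijective conjugation map of $D$ and corresponds under $\iota$ to conjugation by $y + y^{-1}$ on $D^{\varphi}$: $\iota(zrz^{-1}) = (y+y^{-1})\,\iota(r)\,(y+y^{-1})^{-1}$ for all $r \in D$. (b) Others satisfy $z^n \notin D$ for all $n \geq 1$. Namely, there are automorphisms $h_1, h_2, h_3$ of $D$ with $h_1(x) = (1+y)x$, $h_1(y) = y$; $h_2(x) = x$, $h_2(y) = (1+x)y$; $h_3(x) = (1+y)^{-1}x$, $h_3(y) = y$; and there is an element $z \in k_q(y)((x))$ with $z^n \notin D$ for all $n \geq 1$ such that $c_z = h_3 \circ h_2 \circ h_1$ on $D$. (ii) $D$ admits an endomorphism which is not surjective and which is a conjugation map $c_z$ for some $0 \neq z \in k_q(y)((x))$. -/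

import Mathlib

noncomputable section

/-! ### The coefficient field `k(y)` and the automorphism `y ↦ q y` -/

/-- The `k`-automorphism `α` of `k(y)` with `α(y) = q y`. -/
def qShift {k : Type*} [Field k] (q : kˣ) : RatFunc k ≃ₐ[k] RatFunc k :=
  letI : Invertible (q : k) := q.invertible
  IsFractionRing.algEquivOfAlgEquiv (Polynomial.algEquivCMulXAddC (q : k) 0)

theorem qShift_X {k : Type*} [Field k] (q : kˣ) :
    qShift q RatFunc.X = RatFunc.C (q : k) * RatFunc.X := by
  let _ : Invertible (q : k) := q.invertible
  rw [qShift, ← RatFunc.algebraMap_X, IsFractionRing.algEquivOfAlgEquiv_algebraMap,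
    Polynomial.algEquivCMulXAddC_apply]
  simp

/-! ### The ring of Laurent power series `k_q(y)((x))` -/

/-- Elements of `k_q(y)((x))`: formal series `∑_{i ≥ n} a_i x^i` with `n : ℤ` and `a_i ∈ k(y)`,
coefficients written on the left of the powers of `x`. The multiplication defined below is the
twisted one, not that of commutative Laurent series. -/
def QLaurent (k : Type*) [Field k] (_q : kˣ) : Type _ := LaurentSeries (RatFunc k)

namespace QLaurent

variable {k : Type*} [Field k] {q : kˣ}

instance : AddCommGroup (QLaurent k q) :=
  inferInstanceAs (AddCommGroup (LaurentSeries (RatFunc k)))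

/-- The coefficient `a_n` of `∑ a_i x^i`. -/
def coeff (f : QLaurent k q) (n : ℤ) : RatFunc k := HahnSeries.coeff f n

/-- The monomial `a x^n`, where `a ∈ k(y)`. -/
def monomial (n : ℤ) (a : RatFunc k) : QLaurent k q := HahnSeries.single n a

@[ext] theorem ext {f g : QLaurent k q} (h : ∀ n, f.coeff n = g.coeff n) : f = g :=
  HahnSeries.ext (funext h)

theorem coeff_monomial (n m : ℤ) (a : RatFunc k) :
    (monomial n a : QLaurent k q).coeff m = if m = n then a else 0 := by
  rw [coeff, monomial, HahnSeries.coeff_single]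
  congr

theorem support_isPWO (f : QLaurent k q) : (Function.support f.coeff).IsPWO :=
  HahnSeries.isPWO_support f

/-- The multiplication determined by `x a = α(a) x`: the coefficient of `x^n` in
`(∑ a_i x^i) (∑ b_j x^j)` is `∑_{i + j = n} a_i α^i(b_j)` (a finite sum). -/
instance : Mul (QLaurent k q) where
  mul f g :=
    { coeff := fun n => ∑ ij ∈ Finset.antidiagonal f.support_isPWO g.support_isPWO n,
        f.coeff ij.1 * (qShift q ^ ij.1) (g.coeff ij.2)
      isPWO_support' := by
        refine (f.support_isPWO.add g.support_isPWO).mono fun n hn => ?_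
        obtain ⟨ij, hij, -⟩ := Finset.exists_ne_zero_of_sum_ne_zero hn
        rw [Finset.mem_antidiagonal] at hij
        exact Set.mem_add.2 ⟨ij.1, hij.1, ij.2, hij.2.1, hij.2.2⟩ }

instance : One (QLaurent k q) := ⟨monomial 0 1⟩

theorem coeff_mul (f g : QLaurent k q) (n : ℤ) :
    (f * g).coeff n = ∑ ij ∈ Finset.antidiagonal f.support_isPWO g.support_isPWO n,
      f.coeff ij.1 * (qShift q ^ ij.1) (g.coeff ij.2) := rfl

/-- The additive endomorphism `v ↦ a α^i(v)` of `k(y)`. -/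
def opr (q : kˣ) (i : ℤ) (a : RatFunc k) : AddMonoid.End (RatFunc k) :=
  (AddMonoidHom.mulLeft a).comp (qShift q ^ i : RatFunc k ≃ₐ[k] RatFunc k).toRingEquiv.toAddMonoidHom

theorem opr_apply (i : ℤ) (a v : RatFunc k) : opr q i a v = a * (qShift q ^ i) v := rfl

theorem opr_eq_zero {i : ℤ} {a : RatFunc k} : opr q i a = 0 ↔ a = 0 := by
  constructor
  · intro h
    have := DFunLike.congr_fun h 1
    rw [opr_apply, map_one, mul_one] at this
    exact this
  · rintro rfl
    ext v
    simp [opr_apply]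

/-- An auxiliary faithful representation of `k_q(y)((x))`, used to verify the ring axioms. -/
def toHahn (f : QLaurent k q) : HahnSeries ℤ (AddMonoid.End (RatFunc k)) where
  coeff i := opr q i (f.coeff i)
  isPWO_support' := by
    refine f.support_isPWO.mono fun i hi => ?_
    exact fun h => hi (opr_eq_zero.2 h)

theorem toHahn_injective : Function.Injective (toHahn : QLaurent k q → _) := by
  intro f g h
  ext n
  have h1 := DFunLike.congr_fun (congrArg (fun F => HahnSeries.coeff F n) h) 1
  change opr q n (f.coeff n) 1 = opr q n (g.coeff n) 1 at h1
  simpa [opr_apply] using h1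

theorem toHahn_support (f : QLaurent k q) :
    (toHahn f).support = Function.support f.coeff := by
  ext i
  exact not_congr opr_eq_zero

theorem toHahn_add (f g : QLaurent k q) : toHahn (f + g) = toHahn f + toHahn g := by
  ext n v
  exact add_mul (f.coeff n) (g.coeff n) _

theorem toHahn_zero : toHahn (0 : QLaurent k q) = 0 := by
  ext n v
  exact zero_mul _

theorem toHahn_one : toHahn (1 : QLaurent k q) = 1 := by
  ext n v
  change opr q n ((monomial 0 1 : QLaurent k q).coeff n) v = _
  rw [opr_apply, coeff_monomial, HahnSeries.coeff_one]
  split_ifs with h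
  · subst h; simp
  · simp

theorem toHahn_mul (f g : QLaurent k q) : toHahn (f * g) = toHahn f * toHahn g := by
  ext n v
  rw [HahnSeries.coeff_mul]
  change opr q n ((f * g).coeff n) v = _
  rw [opr_apply, coeff_mul, Finset.sum_mul]
  refine Eq.trans ?_ (AddMonoidHom.finsetSum_apply _ _ v).symm
  have hs : Finset.antidiagonal (toHahn f).isPWO_support (toHahn g).isPWO_support n =
      Finset.antidiagonal f.support_isPWO g.support_isPWO n := by
    ext ij
    simp only [Finset.mem_antidiagonal, toHahn_support]
  rw [hs]
  refine Finset.sum_congr rfl fun ij hij => ?_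
  rw [Finset.mem_antidiagonal] at hij
  change _ = opr q ij.1 (f.coeff ij.1) (opr q ij.2 (g.coeff ij.2) v)
  rw [opr_apply, opr_apply, map_mul, ← mul_assoc, ← hij.2.2, zpow_add]
  rfl

theorem mul_assoc_aux (f g h : QLaurent k q) : f * g * h = f * (g * h) :=
  toHahn_injective (by simp only [toHahn_mul, mul_assoc])

instance : Ring (QLaurent k q) where
  __ := (inferInstance : AddCommGroup (QLaurent k q))
  mul_assoc := mul_assoc_aux
  one_mul f := toHahn_injective (by simp only [toHahn_mul, toHahn_one, one_mul])
  mul_one f := toHahn_injective (by simp only [toHahn_mul, toHahn_one, mul_one])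
  left_distrib f g h := toHahn_injective (by simp only [toHahn_mul, toHahn_add, mul_add])
  right_distrib f g h := toHahn_injective (by simp only [toHahn_mul, toHahn_add, add_mul])
  zero_mul f := toHahn_injective (by simp only [toHahn_mul, toHahn_zero, zero_mul])
  mul_zero f := toHahn_injective (by simp only [toHahn_mul, toHahn_zero, mul_zero])

theorem coeff_add (f g : QLaurent k q) (n : ℤ) : (f + g).coeff n = f.coeff n + g.coeff n := rfl

theorem coeff_zero (n : ℤ) : (0 : QLaurent k q).coeff n = 0 := rfl

theorem coeff_one (n : ℤ) : (1 : QLaurent k q).coeff n = if n = 0 then 1 else 0 :=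
  coeff_monomial 0 n 1

/-- The product formula, for series starting at `x^a` and `x^b`. -/
theorem coeff_mul_of_le (f g : QLaurent k q) (a b : ℤ) (hf : ∀ i < a, f.coeff i = 0)
    (hg : ∀ i < b, g.coeff i = 0) (n : ℕ) :
    (f * g).coeff (a + b + n) = ∑ l ∈ Finset.range (n + 1),
      f.coeff (a + l) * (qShift q ^ (a + l : ℤ)) (g.coeff (b + (n - l : ℕ))) := by
  rw [coeff_mul]
  refine Finset.sum_bij_ne_zero (fun ij _ _ => (ij.1 - a).toNat) ?_ ?_ ?_ ?_
  · intro ij hij _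
    rw [Finset.mem_antidiagonal] at hij
    have h1 : a ≤ ij.1 := not_lt.1 fun h => hij.1 (hf _ h)
    have h2 : b ≤ ij.2 := not_lt.1 fun h => hij.2.1 (hg _ h)
    have h3 := hij.2.2
    rw [Finset.mem_range]
    omega
  · intro ij hij _ ij' hij' _ h
    rw [Finset.mem_antidiagonal] at hij hij'
    have h1 : a ≤ ij.1 := not_lt.1 fun h => hij.1 (hf _ h)
    have h1' : a ≤ ij'.1 := not_lt.1 fun h => hij'.1 (hf _ h)
    have h3 := hij.2.2
    have h3' := hij'.2.2
    ext <;> omega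
  · intro l hl hne
    rw [Finset.mem_range] at hl
    have hl' : ((n - l : ℕ) : ℤ) = n - l := by omega
    refine ⟨(a + l, b + (n - l : ℕ)), ?_, ?_, ?_⟩
    · rw [Finset.mem_antidiagonal]
      refine ⟨left_ne_zero_of_mul hne, fun h => right_ne_zero_of_mul hne ?_, ?_⟩
      · rw [h, map_zero]
      · change a + l + (b + ((n - l : ℕ) : ℤ)) = _
        omega
    · exact hne
    · change (a + l - a).toNat = l
      omega
  · intro ij hij _
    rw [Finset.mem_antidiagonal] at hij
    have h1 : a ≤ ij.1 := not_lt.1 fun h => hij.1 (hf _ h)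
    have h2 : b ≤ ij.2 := not_lt.1 fun h => hij.2.1 (hg _ h)
    have h3 := hij.2.2
    have e1 : a + ((ij.1 - a).toNat : ℤ) = ij.1 := by omega
    have e2 : b + ((n - (ij.1 - a).toNat : ℕ) : ℤ) = ij.2 := by omega
    rw [e1, e2]

/-- The coefficients of a left inverse of a series with lowest term `f_a x^a`. -/
def leftInvCoeff (f : QLaurent k q) (a : ℤ) : ℕ → RatFunc k
  | n => ((if n = 0 then 1 else 0) - ∑ l : Fin n,
      leftInvCoeff f a l * (qShift q ^ (-a + (l : ℕ) : ℤ)) (f.coeff (a + (n - l : ℕ)))) /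
        (qShift q ^ (-a + n : ℤ)) (f.coeff a)
  termination_by n => n
  decreasing_by exact l.2

/-- A series whose coefficients vanish below `a`. -/
def ofNat (a : ℤ) (c : ℕ → RatFunc k) : QLaurent k q :=
  HahnSeries.ofSuppBddBelow (fun i => if i < a then 0 else c (i - a).toNat)
    ⟨a, fun _ hi => not_lt.1 fun h => hi (if_pos h)⟩

theorem coeff_ofNat (a : ℤ) (c : ℕ → RatFunc k) (i : ℤ) :
    (ofNat a c : QLaurent k q).coeff i = if i < a then 0 else c (i - a).toNat := rfl

theorem exists_leading (f : QLaurent k q) (hf : f ≠ 0) :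
    ∃ a, f.coeff a ≠ 0 ∧ ∀ i < a, f.coeff i = 0 :=
  ⟨HahnSeries.order f, fun h => hf (HahnSeries.coeff_order_eq_zero.1 h),
    fun _ hi => HahnSeries.coeff_eq_zero_of_lt_order hi⟩

theorem coeff_mul_of_lt (f g : QLaurent k q) (a b : ℤ) (hf : ∀ i < a, f.coeff i = 0)
    (hg : ∀ i < b, g.coeff i = 0) (n : ℤ) (hn : n < a + b) : (f * g).coeff n = 0 := by
  rw [coeff_mul]
  refine Finset.sum_eq_zero fun ij hij => ?_
  rw [Finset.mem_antidiagonal] at hij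
  have h1 : a ≤ ij.1 := not_lt.1 fun h => hij.1 (hf _ h)
  have h2 : b ≤ ij.2 := not_lt.1 fun h => hij.2.1 (hg _ h)
  have h3 := hij.2.2
  omega

theorem exists_left_inv (f : QLaurent k q) (hf : f ≠ 0) : ∃ g : QLaurent k q, g * f = 1 := by
  obtain ⟨a, ha, hlt⟩ := f.exists_leading hf
  refine ⟨ofNat (-a) (leftInvCoeff f a), ?_⟩
  have hg : ∀ i < -a, (ofNat (-a) (leftInvCoeff f a) : QLaurent k q).coeff i = 0 :=
    fun i hi => by rw [coeff_ofNat, if_pos hi]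
  have hg' : ∀ l : ℕ, (ofNat (-a) (leftInvCoeff f a) : QLaurent k q).coeff (-a + l) =
      leftInvCoeff f a l := fun l => by
    rw [coeff_ofNat, if_neg (by omega)]
    congr 1
    omega
  ext n
  rw [coeff_one]
  rcases lt_or_ge n 0 with hn | hn
  · rw [coeff_mul_of_lt _ _ (-a) a hg hlt n (by omega), if_neg (by omega)]
  · obtain ⟨m, rfl⟩ := Int.eq_ofNat_of_zero_le hn
    have h := coeff_mul_of_le _ f (-a) a hg hlt m
    rw [neg_add_cancel, zero_add] at h
    rw [h, Finset.sum_range_succ, hg', Nat.sub_self, Nat.cast_zero, add_zero]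
    have hne : (qShift q ^ (-a + m : ℤ)) (f.coeff a) ≠ 0 := by
      rwa [Ne, EmbeddingLike.map_eq_zero_iff]
    conv_lhs => rw [leftInvCoeff, div_mul_cancel₀ _ hne]
    rw [Finset.sum_congr rfl fun l _ => by rw [hg' l],
      Finset.sum_range (fun l => leftInvCoeff f a l *
        (qShift q ^ (-a + l : ℤ)) (f.coeff (a + (m - l : ℕ)))), add_sub_cancel]
    simp

instance : Nontrivial (QLaurent k q) :=
  ⟨0, 1, fun h => by simpa [coeff_one, coeff_zero] using congrArg (fun f => coeff f 0) h⟩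

theorem isUnit_or_eq_zero (f : QLaurent k q) : IsUnit f ∨ f = 0 := by
  refine or_iff_not_imp_right.2 fun hf => ?_
  obtain ⟨g, hg⟩ := f.exists_left_inv hf
  have hg0 : g ≠ 0 := by
    rintro rfl
    rw [zero_mul] at hg
    exact zero_ne_one hg
  obtain ⟨h, hh⟩ := g.exists_left_inv hg0
  have : h = f := left_inv_eq_right_inv hh hg
  exact ⟨⟨f, g, this ▸ hh, hg⟩, rfl⟩

/-- `k_q(y)((x))` is a division ring. -/
instance : DivisionRing (QLaurent k q) := DivisionRing.ofIsUnitOrEqZero isUnit_or_eq_zero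

theorem monomial_mul_monomial (m n : ℤ) (a b : RatFunc k) :
    (monomial m a * monomial n b : QLaurent k q) = monomial (m + n) (a * (qShift q ^ m) b) := by
  have h1 : ∀ (m : ℤ) (a : RatFunc k), ∀ i < m, (monomial m a : QLaurent k q).coeff i = 0 :=
    fun m a i hi => by rw [coeff_monomial, if_neg hi.ne]
  ext i
  rcases lt_or_ge i (m + n) with hi | hi
  · rw [coeff_mul_of_lt _ _ m n (h1 _ _) (h1 _ _) i hi, h1 _ _ _ hi]
  · obtain ⟨j, hj⟩ := Int.le.dest hi
    rw [← hj, coeff_mul_of_le _ _ m n (h1 _ _) (h1 _ _) j, Finset.sum_range_succ']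
    rw [Finset.sum_eq_zero fun l _ => by rw [coeff_monomial, if_neg (by omega), zero_mul]]
    simp [coeff_monomial]
    split_ifs <;> simp

theorem monomial_add (m : ℤ) (a b : RatFunc k) :
    (monomial m (a + b) : QLaurent k q) = monomial m a + monomial m b := by
  ext i
  simp only [coeff_add, coeff_monomial]
  split_ifs <;> simp

/-- The scalars `k ⊆ k_q(y)((x))`. -/
def scalar (k : Type*) [Field k] (q : kˣ) : k →+* QLaurent k q where
  toFun c := monomial 0 (RatFunc.C c)
  map_one' := by rw [map_one]; rfl
  map_mul' c d := by rw [monomial_mul_monomial]; simp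
  map_zero' := by
    ext i
    rw [coeff_monomial, map_zero, ite_self, coeff_zero]
  map_add' c d := by rw [map_add, monomial_add]

theorem qShift_zpow_C (n : ℤ) (c : k) : (qShift q ^ n) (RatFunc.C c) = RatFunc.C c :=
  (qShift q ^ n).commutes c

theorem exists_mul_scalar (f : QLaurent k q) (c : k) (n : ℤ) :
    (f * scalar k q c).coeff n = RatFunc.C c * f.coeff n ∧
      (scalar k q c * f).coeff n = RatFunc.C c * f.coeff n := by
  rcases eq_or_ne f 0 with rfl | hf
  · simp [coeff_zero]
  obtain ⟨a, -, hlt⟩ := f.exists_leading hf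
  have hs : ∀ i < 0, (scalar k q c).coeff i = 0 := fun i hi => by
    change (monomial 0 _ : QLaurent k q).coeff i = 0
    rw [coeff_monomial, if_neg hi.ne]
  have hs' : ∀ i : ℕ, (scalar k q c).coeff i = if i = 0 then RatFunc.C c else 0 := fun i => by
    change (monomial 0 _ : QLaurent k q).coeff i = _
    rw [coeff_monomial]
    simp
  rcases lt_or_ge n a with hn | hn
  · rw [coeff_mul_of_lt f _ a 0 hlt hs n (by omega), coeff_mul_of_lt _ f 0 a hs hlt n (by omega),
      hlt n hn, mul_zero]
    exact ⟨rfl, rfl⟩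
  obtain ⟨j, hj⟩ := Int.le.dest hn
  have e1 := coeff_mul_of_le f (scalar k q c) a 0 hlt hs j
  have e2 := coeff_mul_of_le (scalar k q c) f 0 a hs hlt j
  rw [add_zero, hj, Finset.sum_range_succ, Finset.sum_eq_zero, zero_add, Nat.sub_self, hj] at e1
  · rw [zero_add, hj, Finset.sum_range_succ', Finset.sum_eq_zero, zero_add] at e2
    · refine ⟨e1.trans ?_, e2.trans ?_⟩
      · rw [zero_add, hs', if_pos rfl, qShift_zpow_C, mul_comm]
      · rw [zero_add, hs', if_pos rfl]
        simp [hj]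
    · intro l _
      rw [zero_add, hs', if_neg (by omega), zero_mul]
  · intro l hl
    rw [Finset.mem_range] at hl
    rw [zero_add, hs', if_neg (by omega), map_zero, mul_zero]

instance : Algebra k (QLaurent k q) :=
  (scalar k q).toAlgebra' fun c f => by
    ext n
    rw [(exists_mul_scalar f c n).1, (exists_mul_scalar f c n).2]

/-- The element `x`. -/
def x : QLaurent k q := monomial 1 1

/-- The element `y`. -/
def y : QLaurent k q := monomial 0 RatFunc.X

/-- The defining relation `x y = q y x`. -/
theorem x_mul_y : (x * y : QLaurent k q) = (q : k) • (y * x) := by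
  rw [Algebra.smul_def]
  change monomial 1 1 * monomial 0 RatFunc.X =
    monomial 0 (RatFunc.C (q : k)) * (monomial 0 RatFunc.X * monomial 1 1)
  simp only [monomial_mul_monomial]
  simp [qShift_X]

end QLaurent

/-! ### The `q`-division ring -/

/-- The quantum plane `k_q[x,y]`, as the `k`-subalgebra of `k_q(y)((x))` generated by `x`, `y`. -/
def quantumPlane (k : Type*) [Field k] (q : kˣ) : Subalgebra k (QLaurent k q) :=
  Algebra.adjoin k {QLaurent.x, QLaurent.y}

/-- The `q`-division ring `D = k_q(x,y)`: the division ring of fractions of the quantum plane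
`k_q[x,y]` inside the division ring `k_q(y)((x))`, i.e. the smallest division subring of
`k_q(y)((x))` that contains `k_q[x,y]`. (`Subfield` does not assume commutativity.) It is
recorded as a `k`-subalgebra. -/
def qDivisionRing (k : Type*) [Field k] (q : kˣ) : Subalgebra k (QLaurent k q) where
  carrier := Subfield.closure (quantumPlane k q : Set (QLaurent k q))
  mul_mem' := mul_mem
  add_mem' := add_mem
  algebraMap_mem' c := Subfield.subset_closure ((quantumPlane k q).algebraMap_mem c)

theorem mem_qDivisionRing {k : Type*} [Field k] {q : kˣ} {z : QLaurent k q} :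
    z ∈ qDivisionRing k q ↔ z ∈ Subfield.closure (quantumPlane k q : Set (QLaurent k q)) :=
  Iff.rfl

theorem qDivisionRing.x_mem (k : Type*) [Field k] (q : kˣ) :
    QLaurent.x ∈ qDivisionRing k q :=
  mem_qDivisionRing.2 (Subfield.subset_closure (Algebra.subset_adjoin (Set.mem_insert _ _)))

theorem qDivisionRing.y_mem (k : Type*) [Field k] (q : kˣ) :
    QLaurent.y ∈ qDivisionRing k q :=
  mem_qDivisionRing.2
    (Subfield.subset_closure (Algebra.subset_adjoin (Set.mem_insert_of_mem _ rfl)))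

/-- The generator `x` of `D`. -/
def qDivisionRing.x (k : Type*) [Field k] (q : kˣ) : qDivisionRing k q :=
  ⟨QLaurent.x, qDivisionRing.x_mem k q⟩

/-- The generator `y` of `D`. -/
def qDivisionRing.y (k : Type*) [Field k] (q : kˣ) : qDivisionRing k q :=
  ⟨QLaurent.y, qDivisionRing.y_mem k q⟩

/-- The endomorphism `θ` of `D` is the conjugation map `c_z : r ↦ z r z⁻¹`, where `z` is an
invertible element of `k_q(y)((x))`. -/
def IsConjugationBy {k : Type*} [Field k] {q : kˣ}
    (θ : qDivisionRing k q →ₐ[k] qDivisionRing k q) (z : QLaurent k q) : Prop :=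
  z ≠ 0 ∧ ∀ r : qDivisionRing k q, (θ r : QLaurent k q) = z * r * z⁻¹

/-- The fixed ring `D^φ` of an automorphism `φ` of `D`, i.e. of the group generated by `φ`. -/
def fixedRing {k : Type*} [Field k] {q : kˣ}
    (φ : qDivisionRing k q ≃ₐ[k] qDivisionRing k q) : Subalgebra k (qDivisionRing k q) :=
  AlgHom.equalizer (φ : qDivisionRing k q →ₐ[k] qDivisionRing k q) (AlgHom.id k _)

theorem mem_fixedRing {k : Type*} [Field k] {q : kˣ}
    (φ : qDivisionRing k q ≃ₐ[k] qDivisionRing k q) (r : qDivisionRing k q) :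
    r ∈ fixedRing φ ↔ φ r = r := Iff.rfl

end

noncomputable section

/-! ### Monomials in `q`-commuting elements -/

/-! Two facts turn everything into a search for suitable pairs of elements of `D`. By
`exists_algHom`, every pair of nonzero elements `X`, `Y` of a division `k`-algebra with `X Y = q Y
X` is the image of `(x, y)` under a unique homomorphism from `D`; the map is built as the division
ring of fractions of a graph. By `exists_conj`, a `q`-commuting pair of series with leading terms
`x` and `y` is simultaneously conjugate to `(x, y)` in `k_q(y)((x))`: the equation `g z = z y` is
solved coefficient by coefficient because `q ^ n ≠ 1`, and the first relation then follows by
itself. So an endomorphism of `D` is a conjugation map as soon as the images of `x` and `y` have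
these leading terms, possibly after an inner automorphism.

For (i)(b), the composite is `h₁⁻¹ h₂ h₁`, and the leading terms are right. If `z ^ n` were in `D`,
then `h₂ ^ n` would send `y` to a conjugate of `y` within `D`; but it sends `y` to `(1 + x) ^ n y`,
whose degree in `x` is wrong.

For (i)(a) and (ii), write `f = φ(x)`, `w = y + y⁻¹`, `v = y - y⁻¹`. The involution fixes `v` and
negates `w`, so it fixes `h = w⁻¹ (x - f)` and `G = w⁻¹ (y x + y⁻¹ f)`. With `Y = G h - q⁻¹` one
gets `h Y = q Y h`, so `x ↦ h`, `y ↦ Y` defines `ι`. Its image `F` contains `G`, `v` and `w² = v² +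
4` and is normalized by `w`, so `D = F + F w`, and separating the `φ`-eigenspaces gives `F = D^φ`.
Conjugation by `w` transported through `ι` is the map `θ` of (i)(a). Its square is inner, and `θ`
itself is not inner because `w` is negated by `φ`. For (ii), a `q`-commuting pair with leading terms
`x`, `y` is found inside `D^φ`; the resulting endomorphism has image in `D^φ`, which omits `y`. -/

theorem eq_zero_of_sum_eigenvectors {k M ι : Type*} [Field k] [AddCommGroup M] [Module k M]
    (f : M →ₗ[k] M) (μ : ι → k) (s : Finset ι) (hμ : Set.InjOn μ s) (v : ι → M)
    (hv : ∀ i ∈ s, f (v i) = μ i • v i) (h0 : ∑ i ∈ s, v i = 0) : ∀ i ∈ s, v i = 0 := by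
  classical
  induction s using Finset.induction_on generalizing v with
  | empty => simp
  | insert a s ha ih =>
    have h1 : ∑ i ∈ s, (μ i - μ a) • v i = 0 := by
      have h2 := congrArg f h0
      rw [map_sum, map_zero, Finset.sum_congr rfl hv] at h2
      have h3 := congrArg (fun m => μ a • m) h0
      simp only [smul_zero, Finset.smul_sum] at h3
      rw [Finset.sum_insert ha] at h2 h3
      simp only [sub_smul, Finset.sum_sub_distrib]
      exact sub_eq_zero.2 (add_left_cancel (h2.trans h3.symm))
    have h4 := ih (hμ.mono (by simp)) (fun i => (μ i - μ a) • v i)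
      (fun i hi => by
        rw [map_smul, hv i (Finset.mem_insert_of_mem hi), smul_comm]) h1
    have h5 : ∀ i ∈ s, v i = 0 := fun i hi => by
      refine (smul_eq_zero.1 (h4 i hi)).resolve_left fun h => ha ?_
      rw [← hμ (by simp [hi]) (by simp) (sub_eq_zero.1 h)]
      exact hi
    intro i hi
    rcases Finset.mem_insert.1 hi with rfl | hi
    · rwa [Finset.sum_insert ha, Finset.sum_eq_zero h5, add_zero] at h0
    · exact h5 i hi

section Monomials

variable {k R : Type*} [Field k] [Ring R] [Algebra k R] {c : k} {u v : R}

theorem mul_pow_of_qComm (h : u * v = c • (v * u)) (i : ℕ) : u * v ^ i = c ^ i • (v ^ i * u) := by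
  induction i with
  | zero => simp
  | succ i ih =>
    rw [pow_succ, ← mul_assoc, ih, smul_mul_assoc, mul_assoc, h, mul_smul_comm, smul_smul,
      ← pow_succ, mul_assoc]

theorem pow_mul_pow_of_qComm (h : u * v = c • (v * u)) (i j : ℕ) :
    u ^ j * v ^ i = c ^ (i * j) • (v ^ i * u ^ j) := by
  induction j with
  | zero => simp
  | succ j ih =>
    rw [pow_succ, mul_assoc, mul_pow_of_qComm h, mul_smul_comm, ← mul_assoc, ih, smul_mul_assoc,
      smul_smul, mul_assoc, ← pow_add]
    congr 2
    ring

variable (k u v) in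
/-- The span of the monomials `v ^ i * u ^ j` with `i, j ≤ d`. -/
def qBox (d : ℕ) : Submodule k R :=
  Submodule.span k (Set.range fun p : Fin (d + 1) × Fin (d + 1) => v ^ (p.1 : ℕ) * u ^ (p.2 : ℕ))

theorem monomial_mem_qBox {d i j : ℕ} (hi : i ≤ d) (hj : j ≤ d) : v ^ i * u ^ j ∈ qBox k u v d :=
  Submodule.subset_span ⟨(⟨i, by omega⟩, ⟨j, by omega⟩), rfl⟩

theorem qBox_mono {d e : ℕ} (h : d ≤ e) : qBox k u v d ≤ qBox k u v e := by
  refine Submodule.span_le.2 ?_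
  rintro _ ⟨⟨⟨i, hi⟩, ⟨j, hj⟩⟩, rfl⟩
  exact monomial_mem_qBox (by omega) (by omega)

theorem mul_mem_qBox (h : u * v = c • (v * u)) {d e : ℕ} {a b : R} (ha : a ∈ qBox k u v d)
    (hb : b ∈ qBox k u v e) : a * b ∈ qBox k u v (d + e) := by
  have := Submodule.mul_mem_mul ha hb
  rw [qBox, qBox, Submodule.span_mul_span] at this
  refine Submodule.span_le.2 ?_ this
  rintro _ ⟨_, ⟨⟨⟨i, hi⟩, ⟨j, hj⟩⟩, rfl⟩, _, ⟨⟨⟨i', hi'⟩, ⟨j', hj'⟩⟩, rfl⟩, rfl⟩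
  have e1 : v ^ i * u ^ j * (v ^ i' * u ^ j') =
      c ^ (i' * j) • (v ^ (i + i') * u ^ (j + j')) := by
    rw [mul_assoc, ← mul_assoc (u ^ j), pow_mul_pow_of_qComm h, pow_add, pow_add]
    simp only [smul_mul_assoc, mul_smul_comm, mul_assoc]
  change v ^ i * u ^ j * (v ^ i' * u ^ j') ∈ _
  rw [e1]
  exact Submodule.smul_mem _ _ (monomial_mem_qBox (by omega) (by omega))

theorem qBox_le_adjoin (d : ℕ) :
    qBox k u v d ≤ Subalgebra.toSubmodule (Algebra.adjoin k {u, v}) := by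
  refine Submodule.span_le.2 ?_
  rintro _ ⟨p, rfl⟩
  exact (Algebra.adjoin k {u, v}).mul_mem (pow_mem (Algebra.subset_adjoin (by simp)) _)
    (pow_mem (Algebra.subset_adjoin (by simp)) _)

theorem exists_mem_qBox (h : u * v = c • (v * u)) {a : R} (ha : a ∈ Algebra.adjoin k {u, v}) :
    ∃ d, a ∈ qBox k u v d := by
  induction ha using Algebra.adjoin_induction with
  | mem x hx =>
    refine ⟨1, ?_⟩
    rcases hx with rfl | rfl
    · simpa using monomial_mem_qBox (k := k) (u := x) (v := v) (d := 1) (i := 0) (j := 1)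
        (by omega) le_rfl
    · simpa using monomial_mem_qBox (k := k) (u := u) (v := x) (d := 1) (i := 1) (j := 0)
        le_rfl (by omega)
  | algebraMap r =>
    refine ⟨0, ?_⟩
    rw [Algebra.algebraMap_eq_smul_one]
    refine Submodule.smul_mem _ _ ?_
    simpa using monomial_mem_qBox (k := k) (u := u) (v := v) (d := 0) (i := 0) (j := 0) le_rfl
      le_rfl
  | add x y _ _ hx hy =>
    obtain ⟨d, hd⟩ := hx
    obtain ⟨e, he⟩ := hy
    exact ⟨max d e, add_mem (qBox_mono (le_max_left _ _) hd) (qBox_mono (le_max_right _ _) he)⟩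
  | mul x y _ _ hx hy =>
    obtain ⟨d, hd⟩ := hx
    obtain ⟨e, he⟩ := hy
    exact ⟨d + e, mul_mem_qBox h hd he⟩

instance (d : ℕ) : FiniteDimensional k (qBox k u v d) :=
  FiniteDimensional.span_of_finite k (Set.finite_range _)

theorem finrank_qBox (hl : LinearIndependent k fun p : ℕ × ℕ => v ^ p.1 * u ^ p.2) (d : ℕ) :
    Module.finrank k (qBox k u v d) = (d + 1) * (d + 1) := by
  have := hl.comp (fun p : Fin (d + 1) × Fin (d + 1) => ((p.1 : ℕ), (p.2 : ℕ))) (by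
    rintro ⟨⟨a, _⟩, ⟨b, _⟩⟩ ⟨⟨a', _⟩, ⟨b', _⟩⟩ h
    simpa using h)
  rw [qBox]
  exact (finrank_span_eq_card this).trans (by simp)

/-- The left Ore condition, by comparing dimensions. -/
theorem exists_ore (h : u * v = c • (v * u))
    (hl : LinearIndependent k fun p : ℕ × ℕ => v ^ p.1 * u ^ p.2) {a b : R}
    (ha : a ∈ Algebra.adjoin k {u, v}) (hb : b ∈ Algebra.adjoin k {u, v}) :
    ∃ r ∈ Algebra.adjoin k {u, v}, ∃ s ∈ Algebra.adjoin k {u, v},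
      (r ≠ 0 ∨ s ≠ 0) ∧ r * a = s * b := by
  obtain ⟨d, hd⟩ := exists_mem_qBox h ha
  obtain ⟨e, he⟩ := exists_mem_qBox h hb
  replace hd := qBox_mono (le_max_left d e) hd
  replace he := qBox_mono (le_max_right d e) he
  set m := max d e
  -- The map `(r, s) ↦ r a - s b` goes from dimension `2 (3m + 1)²` to dimension `(4m + 1)²`. The
  -- factor 3 makes the former larger for every `m`, so the kernel is nonzero.
  let F : (qBox k u v (3 * m) × qBox k u v (3 * m)) →ₗ[k] qBox k u v (3 * m + m) :=
    (((LinearMap.mulRight k a).comp (qBox k u v (3 * m)).subtype).coprod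
      (-(LinearMap.mulRight k b).comp (qBox k u v (3 * m)).subtype)).codRestrict _ fun p => by
        have : (p.1 : R) * a - p.2 * b ∈ qBox k u v (3 * m + m) :=
          sub_mem (mul_mem_qBox h p.1.2 hd) (mul_mem_qBox h p.2.2 he)
        simpa [sub_eq_add_neg] using this
  have hF : LinearMap.ker F ≠ ⊥ := by
    refine LinearMap.ker_ne_bot_of_finrank_lt ?_
    rw [Module.finrank_prod, finrank_qBox hl, finrank_qBox hl]
    nlinarith
  obtain ⟨⟨r, s⟩, hrs, hne⟩ := (Submodule.ne_bot_iff _).1 hF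
  refine ⟨r, qBox_le_adjoin _ r.2, s, qBox_le_adjoin _ s.2, ?_, ?_⟩
  · by_contra! hcon
    exact hne (by ext <;> simp [hcon.1, hcon.2])
  · have := congrArg Subtype.val (LinearMap.mem_ker.1 hrs)
    simpa [F, ← sub_eq_add_neg, sub_eq_zero] using this

end Monomials

/-- Each monomial `Y ^ i * X ^ j` is an eigenvector of `r ↦ X r X⁻¹` with eigenvalue `c ^ i` and of
`r ↦ Y⁻¹ r Y` with eigenvalue `c ^ j`. The first map separates the exponents of `Y`, the second
those of `X`. -/
theorem linearIndependent_qMonomial {k E : Type*} [Field k] [DivisionRing E] [Algebra k E] {c : k}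
    (hc : Function.Injective fun n : ℕ => c ^ n) {X Y : E} (hX : X ≠ 0) (hY : Y ≠ 0)
    (h : X * Y = c • (Y * X)) : LinearIndependent k fun p : ℕ × ℕ => Y ^ p.1 * X ^ p.2 := by
  classical
  rw [linearIndependent_iff']
  intro s g hg
  have h1 : ∀ i ∈ s.image Prod.fst,
      ∑ p ∈ s with p.1 = i, g p • (Y ^ p.1 * X ^ p.2) = 0 := by
    refine eq_zero_of_sum_eigenvectors
      ((LinearMap.mulLeft k X).comp (LinearMap.mulRight k X⁻¹)) (fun i => c ^ i) _ hc.injOn _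
      (fun i _ => ?_) ?_
    · rw [map_sum, Finset.smul_sum]
      refine Finset.sum_congr rfl fun p hp => ?_
      rw [map_smul, smul_comm, ← (Finset.mem_filter.1 hp).2]
      congr 1
      simp only [LinearMap.comp_apply, LinearMap.mulRight_apply, LinearMap.mulLeft_apply]
      rw [← mul_assoc, ← mul_assoc, mul_pow_of_qComm h, smul_mul_assoc, mul_assoc _ X,
        ← pow_succ', smul_mul_assoc, mul_assoc, pow_succ, mul_inv_cancel_right₀ hX]
    · rw [← hg]
      exact Finset.sum_fiberwise_of_maps_to (fun p hp => Finset.mem_image_of_mem _ hp) _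
  intro p hp
  have h2 := eq_zero_of_sum_eigenvectors
    ((LinearMap.mulLeft k Y⁻¹).comp (LinearMap.mulRight k Y)) (fun p : ℕ × ℕ => c ^ p.2) _
    (fun a ha b hb hab => Prod.ext
      ((Finset.mem_filter.1 ha).2.trans (Finset.mem_filter.1 hb).2.symm) (hc hab)) _
    (fun r _ => ?_) (h1 p.1 (Finset.mem_image_of_mem _ hp)) p (by simp [hp])
  · exact (smul_eq_zero.1 h2).resolve_right
      (mul_ne_zero (pow_ne_zero _ hY) (pow_ne_zero _ hX))
  · rw [map_smul, smul_comm]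
    congr 1
    simp only [LinearMap.comp_apply, LinearMap.mulRight_apply, LinearMap.mulLeft_apply]
    have h3 := pow_mul_pow_of_qComm h 1 r.2
    rw [pow_one, one_mul] at h3
    rw [mul_assoc, h3, mul_smul_comm, mul_smul_comm, ← mul_assoc, ← mul_assoc, mul_assoc Y⁻¹,
      ← pow_succ, pow_succ', inv_mul_cancel_left₀ hY]

/-! ### Left fractions -/

section Fractions

variable {k R : Type*} [Field k] [Ring R] [Algebra k R]

/-- The elements `r` with `a * r ∈ A` for some nonzero `a ∈ A`. -/
def leftFractions (A : Subalgebra k R) : Set R := {r | ∃ a ∈ A, a ≠ 0 ∧ a * r ∈ A}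

variable {A : Subalgebra k R}

theorem mem_leftFractions [Nontrivial R] {a : R} (ha : a ∈ A) : a ∈ leftFractions A :=
  ⟨1, one_mem _, one_ne_zero, by simpa using ha⟩

theorem neg_mem_leftFractions {r : R} (hr : r ∈ leftFractions A) : -r ∈ leftFractions A := by
  obtain ⟨a, ha, ha0, har⟩ := hr
  exact ⟨a, ha, ha0, by rw [mul_neg]; exact neg_mem har⟩

/-- Regularity of the elements of `A` is a hypothesis because the ambient ring will be a product `E₁
× E₂`, which has zero divisors. It upgrades "`r` or `s` is nonzero" to `r ≠ 0`. -/
theorem exists_common_multiple (hmul : ∀ a ∈ A, a ≠ 0 → ∀ r : R, a * r = 0 → r = 0)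
    (hore : ∀ a ∈ A, ∀ b ∈ A, ∃ r ∈ A, ∃ s ∈ A, (r ≠ 0 ∨ s ≠ 0) ∧ r * a = s * b) {a b : R}
    (ha : a ∈ A) (hb : b ∈ A) (hb0 : b ≠ 0) :
    ∃ r ∈ A, ∃ s ∈ A, r ≠ 0 ∧ r * a = s * b := by
  obtain ⟨c, hc, d, hd, hcd, e⟩ := hore a ha b hb
  refine ⟨c, hc, d, hd, ?_, e⟩
  rintro rfl
  rw [zero_mul] at e
  exact hcd.elim (fun h => h rfl) fun h => hb0 (hmul d hd h b e.symm)

theorem mul_mem_leftFractions (hmul : ∀ a ∈ A, a ≠ 0 → ∀ r : R, a * r = 0 → r = 0)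
    (hore : ∀ a ∈ A, ∀ b ∈ A, ∃ r ∈ A, ∃ s ∈ A, (r ≠ 0 ∨ s ≠ 0) ∧ r * a = s * b) {r s : R}
    (hr : r ∈ leftFractions A) (hs : s ∈ leftFractions A) : r * s ∈ leftFractions A := by
  obtain ⟨a, ha, ha0, har⟩ := hr
  obtain ⟨b, hb, hb0, hbs⟩ := hs
  obtain ⟨c, hc, d, hd, hc0, e⟩ := exists_common_multiple hmul hore har hb hb0
  refine ⟨c * a, mul_mem hc ha, fun h => ha0 (hmul c hc hc0 a h), ?_⟩
  rw [mul_assoc, ← mul_assoc a, ← mul_assoc c, e, mul_assoc]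
  exact mul_mem hd hbs

theorem add_mem_leftFractions (hmul : ∀ a ∈ A, a ≠ 0 → ∀ r : R, a * r = 0 → r = 0)
    (hore : ∀ a ∈ A, ∀ b ∈ A, ∃ r ∈ A, ∃ s ∈ A, (r ≠ 0 ∨ s ≠ 0) ∧ r * a = s * b) {r s : R}
    (hr : r ∈ leftFractions A) (hs : s ∈ leftFractions A) : r + s ∈ leftFractions A := by
  obtain ⟨a, ha, ha0, har⟩ := hr
  obtain ⟨b, hb, hb0, hbs⟩ := hs
  obtain ⟨c, hc, d, hd, hc0, e⟩ := exists_common_multiple hmul hore ha hb hb0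
  refine ⟨c * a, mul_mem hc ha, fun h => ha0 (hmul c hc hc0 a h), ?_⟩
  rw [mul_add]
  refine add_mem ?_ ?_
  · rw [mul_assoc]; exact mul_mem hc har
  · rw [e, mul_assoc]; exact mul_mem hd hbs

end Fractions

/-- The monomials in `u` and `v` are independent, so a linear map along which they stay
independent is injective on the algebra that `u` and `v` generate. -/
theorem eq_zero_of_map_eq_zero {k R M : Type*} [Field k] [Ring R] [Algebra k R] [AddCommGroup M]
    [Module k M] {c : k} {u v : R} (h : u * v = c • (v * u)) (f : R →ₗ[k] M)
    (hl : LinearIndependent k fun p : ℕ × ℕ => f (v ^ p.1 * u ^ p.2)) {a : R}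
    (ha : a ∈ Algebra.adjoin k {u, v}) (h0 : f a = 0) : a = 0 := by
  obtain ⟨d, hd⟩ := exists_mem_qBox h ha
  have hs : a ∈ Submodule.span k (Set.range fun p : ℕ × ℕ => v ^ p.1 * u ^ p.2) := by
    refine Submodule.span_mono ?_ hd
    rintro _ ⟨p, rfl⟩
    exact ⟨(p.1, p.2), rfl⟩
  obtain ⟨c, rfl⟩ := Finsupp.mem_span_range_iff_exists_finsupp.1 hs
  have h1 : c = 0 := by
    refine linearIndependent_iff.1 hl c ?_
    rw [Finsupp.sum, map_sum] at h0
    simpa only [map_smul, Finsupp.linearCombination_apply, Finsupp.sum] using h0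
  simp [h1]

/-! ### The universal property of the `q`-division ring -/

/-- Two `q`-commuting pairs in division rings: the first generates a division ring that maps to
the second ring, carrying the first pair to the second. -/
theorem exists_ringHom_of_qComm {k E₁ E₂ : Type*} [Field k] [DivisionRing E₁] [Algebra k E₁]
    [DivisionRing E₂] [Algebra k E₂] {c : k} (hinj : Function.Injective fun n : ℕ => c ^ n)
    {X₁ Y₁ : E₁} {X₂ Y₂ : E₂} (hX₁ : X₁ ≠ 0) (hY₁ : Y₁ ≠ 0) (h₁ : X₁ * Y₁ = c • (Y₁ * X₁))
    (hX₂ : X₂ ≠ 0) (hY₂ : Y₂ ≠ 0) (h₂ : X₂ * Y₂ = c • (Y₂ * X₂)) :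
    ∃ (S : Subfield E₁) (f : S →+* E₂),
      (∀ a, ∃ h : algebraMap k E₁ a ∈ S, f ⟨_, h⟩ = algebraMap k E₂ a) ∧
      (∃ h : X₁ ∈ S, f ⟨_, h⟩ = X₂) ∧ ∃ h : Y₁ ∈ S, f ⟨_, h⟩ = Y₂ := by
  -- `A` is the graph of the desired map on polynomials. Monomials are independent in both
  -- coordinates, so both projections are injective on `A`; a nonzero element of `A` then has two
  -- nonzero coordinates and is regular.
  obtain ⟨A, hu, hv, hA1, hA2, hore⟩ : ∃ A : Subalgebra k (E₁ × E₂),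
      (X₁, X₂) ∈ A ∧ (Y₁, Y₂) ∈ A ∧ (∀ a ∈ A, a.1 = 0 → a = 0) ∧
      (∀ a ∈ A, a.2 = 0 → a = 0) ∧
      ∀ a ∈ A, ∀ b ∈ A, ∃ r ∈ A, ∃ s ∈ A, (r ≠ 0 ∨ s ≠ 0) ∧ r * a = s * b := by
    have huv : ((X₁, X₂) : E₁ × E₂) * (Y₁, Y₂) =
        c • ((Y₁, Y₂) * (X₁, X₂)) := Prod.ext h₁ h₂
    have hl1 := linearIndependent_qMonomial hinj hX₁ hY₁ h₁
    have hl2 := linearIndependent_qMonomial hinj hX₂ hY₂ h₂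
    refine ⟨Algebra.adjoin k {(X₁, X₂), (Y₁, Y₂)},
      Algebra.subset_adjoin (by simp), Algebra.subset_adjoin (by simp),
      fun a ha h0 => eq_zero_of_map_eq_zero huv (LinearMap.fst k _ _) ?_ ha h0,
      fun a ha h0 => eq_zero_of_map_eq_zero huv (LinearMap.snd k _ _) ?_ ha h0,
      fun a ha b hb => exists_ore huv (LinearIndependent.of_comp (LinearMap.fst k _ _) ?_) ha hb⟩
    · simpa using hl1
    · simpa using hl2
    · simpa [Function.comp_def] using hl1
  have hmul : ∀ a ∈ A, a ≠ 0 → ∀ r : E₁ × E₂, a * r = 0 → r = 0 := by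
    intro a ha ha0 r hr
    have h1 : a.1 ≠ 0 := fun h => ha0 (hA1 a ha h)
    have h2 : a.2 ≠ 0 := fun h => ha0 (hA2 a ha h)
    exact Prod.ext ((mul_eq_zero.1 (congrArg Prod.fst hr)).resolve_left h1)
      ((mul_eq_zero.1 (congrArg Prod.snd hr)).resolve_left h2)
  have hG1 : ∀ r ∈ leftFractions A, r.1 = 0 → r = 0 := by
    rintro r ⟨a, ha, ha0, har⟩ h0
    exact hmul a ha ha0 r (hA1 _ har (by rw [Prod.fst_mul, h0, mul_zero]))
  have hG2 : ∀ r ∈ leftFractions A, r.2 = 0 → r = 0 := by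
    rintro r ⟨a, ha, ha0, har⟩ h0
    exact hmul a ha ha0 r (hA2 _ har (by rw [Prod.snd_mul, h0, mul_zero]))
  have hinv : ∀ r ∈ leftFractions A, (r.1⁻¹, r.2⁻¹) ∈ leftFractions A := by
    rintro r hr
    rcases eq_or_ne r 0 with rfl | hr0
    · have : ((0 : E₁ × E₂).1⁻¹, (0 : E₁ × E₂).2⁻¹) = 0 := by
        ext <;> simp
      rw [this]
      exact hr
    have hr1 : r.1 ≠ 0 := fun h => hr0 (hG1 r hr h)
    have hr2 : r.2 ≠ 0 := fun h => hr0 (hG2 r hr h)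
    obtain ⟨a, ha, ha0, har⟩ := hr
    refine ⟨a * r, har, fun h => hr0 (hmul a ha ha0 r h), ?_⟩
    have : a * r * (r.1⁻¹, r.2⁻¹) = a := by
      refine Prod.ext ?_ ?_
      · exact mul_inv_cancel_right₀ hr1 _
      · exact mul_inv_cancel_right₀ hr2 _
    rwa [this]
  -- Injectivity of the first projection on fractions says that the set of fractions is the graph of
  -- a function.
  have huniq : ∀ {a b b'}, (a, b) ∈ leftFractions A → (a, b') ∈ leftFractions A → b = b' := by
    intro a b b' hb hb'
    have := hG1 _ (add_mem_leftFractions hmul hore hb (neg_mem_leftFractions hb'))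
      (add_neg_cancel a)
    exact add_neg_eq_zero.1 (congrArg Prod.snd this)
  let S : Subfield (E₁) :=
    { carrier := {a | ∃ b, (a, b) ∈ leftFractions A}
      mul_mem' := fun ⟨b, hb⟩ ⟨b', hb'⟩ => ⟨b * b', mul_mem_leftFractions hmul hore hb hb'⟩
      add_mem' := fun ⟨b, hb⟩ ⟨b', hb'⟩ => ⟨b + b', add_mem_leftFractions hmul hore hb hb'⟩
      one_mem' := ⟨1, mem_leftFractions (one_mem A)⟩
      zero_mem' := ⟨0, mem_leftFractions (zero_mem A)⟩
      neg_mem' := fun ⟨b, hb⟩ => ⟨-b, neg_mem_leftFractions hb⟩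
      inv_mem' := fun _ ⟨b, hb⟩ => ⟨b⁻¹, hinv _ hb⟩ }
  have hex : ∀ a : S, ∃ b, ((a : E₁), b) ∈ leftFractions A := fun a => a.2
  choose f hf using hex
  let F : S →+* E₂ :=
    { toFun := f
      map_one' := huniq (hf 1) (mem_leftFractions (one_mem A))
      map_mul' := fun a b => huniq (hf (a * b)) (mul_mem_leftFractions hmul hore (hf a) (hf b))
      map_zero' := huniq (hf 0) (mem_leftFractions (zero_mem A))
      map_add' := fun a b => huniq (hf (a + b)) (add_mem_leftFractions hmul hore (hf a) (hf b)) }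
  have key : ∀ {a b}, (a, b) ∈ leftFractions A → ∃ h : a ∈ S, F ⟨_, h⟩ = b := fun {a b} h =>
    ⟨⟨b, h⟩, huniq (hf ⟨a, b, h⟩) h⟩
  exact ⟨S, F, fun a => key (mem_leftFractions (A.algebraMap_mem a)), key (mem_leftFractions hu),
    key (mem_leftFractions hv)⟩

theorem pow_injective_of_not_root {k : Type*} [Field k] {q : kˣ}
    (hq : ∀ n : ℕ, 1 ≤ n → (q : k) ^ n ≠ 1) : Function.Injective fun n : ℕ => (q : k) ^ n := by
  have hlt : ∀ m n : ℕ, m < n → (q : k) ^ m ≠ (q : k) ^ n := fun m n hmn h => by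
    refine hq (n - m) (by omega) ?_
    have h0 : (q : k) ^ m ≠ 0 := pow_ne_zero _ q.ne_zero
    refine mul_left_cancel₀ h0 ?_
    rw [← pow_add, mul_one, h]
    congr 1
    omega
  intro m n hmn
  rcases lt_trichotomy m n with hl | hl | hl
  · exact absurd hmn (hlt _ _ hl)
  · exact hl
  · exact absurd hmn.symm (hlt _ _ hl)

namespace qDivisionRing

variable {k : Type*} [Field k] {q : kˣ}

theorem inv_mem {a : QLaurent k q} (ha : a ∈ qDivisionRing k q) : a⁻¹ ∈ qDivisionRing k q :=
  mem_qDivisionRing.2 (Subfield.inv_mem _ (mem_qDivisionRing.1 ha))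

instance : DivisionRing (qDivisionRing k q) where
  __ := (qDivisionRing k q).toRing
  inv a := ⟨(a : QLaurent k q)⁻¹, inv_mem a.2⟩
  exists_pair_ne := ⟨0, 1, fun h => zero_ne_one (congrArg Subtype.val h)⟩
  mul_inv_cancel a ha :=
    Subtype.ext (mul_inv_cancel₀ (a := (a : QLaurent k q)) fun h => ha (Subtype.ext h))
  inv_zero := Subtype.ext (inv_zero (G₀ := QLaurent k q))
  nnqsmul := _
  qsmul := _

theorem le_of_generators (S : Subfield (QLaurent k q))
    (hk : ∀ c : k, algebraMap k (QLaurent k q) c ∈ S) (hx : QLaurent.x ∈ S)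
    (hy : QLaurent.y ∈ S) {a : QLaurent k q} (ha : a ∈ qDivisionRing k q) : a ∈ S := by
  refine (Subfield.closure_le (t := S)).2 ?_ (mem_qDivisionRing.1 ha)
  let T : Subalgebra k (QLaurent k q) :=
    { S.toSubring.toSubsemiring with algebraMap_mem' := hk }
  have : quantumPlane k q ≤ T := by
    refine Algebra.adjoin_le ?_
    rintro _ (rfl | rfl)
    exacts [hx, hy]
  exact this

theorem mem_of_generators (S : Subfield (qDivisionRing k q))
    (hk : ∀ c : k, algebraMap k (qDivisionRing k q) c ∈ S) (hx : x k q ∈ S)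
    (hy : y k q ∈ S) (a : qDivisionRing k q) : a ∈ S := by
  obtain ⟨b, hb, hab⟩ := le_of_generators
    (S.map (qDivisionRing k q).val.toRingHom) (fun c => ⟨_, hk c, rfl⟩) ⟨_, hx, rfl⟩
    ⟨_, hy, rfl⟩ a.2
  have : b = a := Subtype.ext hab
  exact this ▸ hb

theorem algHom_ext {E : Type*} [DivisionRing E] [Algebra k E] {f g : qDivisionRing k q →ₐ[k] E}
    (hx : f (x k q) = g (x k q)) (hy : f (y k q) = g (y k q)) : f = g :=
  AlgHom.ext fun a => mem_of_generators
    ((f : qDivisionRing k q →+* E).eqLocusField (g : qDivisionRing k q →+* E))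
    (fun c => (f.commutes c).trans (g.commutes c).symm) hx hy a

theorem x_ne_zero : (QLaurent.x : QLaurent k q) ≠ 0 := fun h => by
  have := congrArg (fun f => QLaurent.coeff f 1) h
  simp [QLaurent.x, QLaurent.coeff_monomial, QLaurent.coeff_zero] at this

theorem y_ne_zero : (QLaurent.y : QLaurent k q) ≠ 0 := fun h => by
  have := congrArg (fun f => QLaurent.coeff f 0) h
  exact RatFunc.X_ne_zero (by simpa [QLaurent.y, QLaurent.coeff_monomial, QLaurent.coeff_zero]
    using this)

/-- The target may be `D` itself, so this produces the endomorphisms of `D`; together with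
`algHom_ext` it identifies them with the `q`-commuting pairs of nonzero elements. -/
theorem exists_algHom (hq : ∀ n : ℕ, 1 ≤ n → (q : k) ^ n ≠ 1) {E : Type*} [DivisionRing E]
    [Algebra k E] (X Y : E) (hX : X ≠ 0) (hY : Y ≠ 0) (h : X * Y = (q : k) • (Y * X)) :
    ∃ f : qDivisionRing k q →ₐ[k] E, f (x k q) = X ∧ f (y k q) = Y := by
  obtain ⟨S, f, hk, ⟨hxS, hx⟩, ⟨hyS, hy⟩⟩ := exists_ringHom_of_qComm
    (pow_injective_of_not_root hq) x_ne_zero y_ne_zero QLaurent.x_mul_y hX hY h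
  have hS : ∀ a ∈ qDivisionRing k q, a ∈ S := fun a ha =>
    le_of_generators S (fun c => (hk c).1) hxS hyS ha
  let g : qDivisionRing k q →+* S :=
    (qDivisionRing k q).val.toRingHom.codRestrict S fun a => hS a a.2
  exact ⟨{ f.comp g with commutes' := fun c => (hk c).2 }, hx, hy⟩

end qDivisionRing

/-! ### The automorphism `y ↦ q y` of `k(y)` -/

section Shift

variable {k : Type*} [Field k] {q : kˣ}

theorem zpow_eq_one_of_not_root (hq : ∀ n : ℕ, 1 ≤ n → (q : k) ^ n ≠ 1) {n : ℤ}
    (h : q ^ n = 1) : n = 0 := by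
  by_contra hn
  have h1 : q ^ n.natAbs = 1 := by
    rcases Int.natAbs_eq n with e | e
    · rw [e, zpow_natCast] at h; exact h
    · rw [e, zpow_neg, inv_eq_one, zpow_natCast] at h; exact h
  exact hq n.natAbs (by omega) (by rw [← Units.val_pow_eq_pow_val, h1, Units.val_one])

theorem qShift_zpow_X (n : ℤ) :
    (qShift q ^ n) RatFunc.X = RatFunc.C ((q ^ n : kˣ) : k) * RatFunc.X := by
  have hnat : ∀ (q : kˣ) (n : ℕ),
      (qShift q ^ n) RatFunc.X = RatFunc.C ((q ^ n : kˣ) : k) * RatFunc.X := by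
    intro q n
    induction n with
    | zero => simp
    | succ n ih =>
      have hC : ∀ c : k, qShift q (RatFunc.C c) = RatFunc.C c := (qShift q).commutes
      rw [pow_succ', AlgEquiv.mul_apply, ih, map_mul, qShift_X, hC, ← mul_assoc, ← map_mul,
        ← Units.val_mul, ← pow_succ]
  obtain ⟨m, rfl | rfl⟩ := n.eq_nat_or_neg
  · exact hnat q m
  · rw [zpow_neg]
    refine (AlgEquiv.symm_apply_eq (qShift q ^ (m : ℤ))).2 ?_
    rw [map_mul, QLaurent.qShift_zpow_C, zpow_natCast, hnat, ← mul_assoc, ← map_mul,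
      ← Units.val_mul]
    simp

theorem qShift_algebraMap (p : Polynomial k) :
    qShift q (algebraMap _ (RatFunc k) p) =
      algebraMap _ (RatFunc k) (p.comp (Polynomial.C (q : k) * Polynomial.X)) := by
  let _ : Invertible (q : k) := q.invertible
  rw [qShift, IsFractionRing.algEquivOfAlgEquiv_algebraMap, Polynomial.algEquivCMulXAddC_apply]
  simp [Polynomial.aeval_def, Polynomial.comp, Polynomial.eval₂_def]

/-- A fraction that is invariant under `y ↦ q y` has degree zero. -/
theorem natDegree_eq_of_qShift_eq (hq : ∀ n : ℕ, 1 ≤ n → (q : k) ^ n ≠ 1) {p r : Polynomial k}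
    (hp : p ≠ 0) (hr : r ≠ 0)
    (h : qShift q (algebraMap _ (RatFunc k) p / algebraMap _ (RatFunc k) r) =
      algebraMap _ (RatFunc k) p / algebraMap _ (RatFunc k) r) : p.natDegree = r.natDegree := by
  have hinj := RatFunc.algebraMap_injective k
  have hr' : algebraMap _ (RatFunc k) r ≠ 0 := (map_ne_zero_iff _ hinj).2 hr
  have hr'' : qShift q (algebraMap _ (RatFunc k) r) ≠ 0 := by
    rwa [Ne, EmbeddingLike.map_eq_zero_iff]
  rw [map_div₀, div_eq_div_iff hr'' hr', qShift_algebraMap, qShift_algebraMap, ← map_mul,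
    ← map_mul] at h
  have hd : (Polynomial.C (q : k) * Polynomial.X).natDegree = 1 :=
    Polynomial.natDegree_C_mul_X _ q.ne_zero
  have h1 := congrArg Polynomial.leadingCoeff (hinj h)
  rw [Polynomial.leadingCoeff_mul, Polynomial.leadingCoeff_mul,
    Polynomial.leadingCoeff_comp (by rw [hd]; exact one_ne_zero),
    Polynomial.leadingCoeff_comp (by rw [hd]; exact one_ne_zero),
    Polynomial.leadingCoeff_mul, Polynomial.leadingCoeff_C, Polynomial.leadingCoeff_X,
    mul_one] at h1
  have hp0 := Polynomial.leadingCoeff_ne_zero.2 hp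
  have hr0 := Polynomial.leadingCoeff_ne_zero.2 hr
  refine pow_injective_of_not_root hq (mul_left_cancel₀ (mul_ne_zero hp0 hr0) ?_)
  change p.leadingCoeff * r.leadingCoeff * (q : k) ^ p.natDegree =
    p.leadingCoeff * r.leadingCoeff * (q : k) ^ r.natDegree
  linear_combination h1

/-- Numerator and denominator of `b` have equal degree. Subtracting the ratio `c` of their leading
coefficients gives an invariant fraction of negative degree, which must vanish. -/
theorem exists_C_of_qShift_eq (hq : ∀ n : ℕ, 1 ≤ n → (q : k) ^ n ≠ 1) {b : RatFunc k}
    (hb : qShift q b = b) : ∃ c : k, b = RatFunc.C c := by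
  rcases eq_or_ne b 0 with rfl | hb0
  · exact ⟨0, by simp⟩
  have hr := b.denom_ne_zero
  have hp : b.num ≠ 0 := RatFunc.num_ne_zero hb0
  have hr' : algebraMap _ (RatFunc k) b.denom ≠ 0 :=
    (map_ne_zero_iff _ (RatFunc.algebraMap_injective k)).2 hr
  have hd := natDegree_eq_of_qShift_eq hq hp hr (by rw [RatFunc.num_div_denom, hb])
  set c := b.num.leadingCoeff / b.denom.leadingCoeff
  have hc : c ≠ 0 := div_ne_zero (Polynomial.leadingCoeff_ne_zero.2 hp)
    (Polynomial.leadingCoeff_ne_zero.2 hr)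
  refine ⟨c, ?_⟩
  have e : algebraMap _ (RatFunc k) (b.num - Polynomial.C c * b.denom) /
      algebraMap _ (RatFunc k) b.denom = b - RatFunc.C c := by
    rw [map_sub, map_mul, sub_div, RatFunc.num_div_denom, mul_div_cancel_right₀ _ hr',
      RatFunc.algebraMap_C]
  by_contra hne
  have h0 : b.num - Polynomial.C c * b.denom ≠ 0 := by
    intro h
    rw [h, map_zero, zero_div] at e
    exact hne (sub_eq_zero.1 e.symm)
  have h1 := natDegree_eq_of_qShift_eq hq h0 hr (by
    rw [e, map_sub, hb]
    congr 1
    exact (qShift q).commutes c)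
  have h2 : (b.num - Polynomial.C c * b.denom).degree < b.num.degree := by
    refine Polynomial.degree_sub_lt_left ?_ hp ?_
    · rw [Polynomial.degree_C_mul hc, Polynomial.degree_eq_natDegree hp,
        Polynomial.degree_eq_natDegree hr, hd]
    · rw [Polynomial.leadingCoeff_mul, Polynomial.leadingCoeff_C,
        div_mul_cancel₀ _ (Polynomial.leadingCoeff_ne_zero.2 hr)]
  rw [Polynomial.degree_eq_natDegree hp, Polynomial.degree_eq_natDegree h0, h1, hd] at h2
  exact lt_irrefl _ h2

end Shift

/-! ### Leading terms of Laurent series -/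

namespace QLaurent

variable {k : Type*} [Field k] {q : kˣ}

theorem toHahn_monomial (m : ℤ) (b : RatFunc k) :
    toHahn (monomial m b : QLaurent k q) = HahnSeries.single m (opr q m b) := by
  ext n v
  change opr q n ((monomial m b : QLaurent k q).coeff n) v = _
  rw [coeff_monomial, HahnSeries.coeff_single]
  split_ifs with h
  · rw [h]
  · simp [opr_apply]

theorem coeff_mul_monomial (f : QLaurent k q) (m n : ℤ) (b : RatFunc k) :
    (f * monomial m b).coeff (n + m) = f.coeff n * (qShift q ^ n) b := by
  have h := congrArg (fun F : HahnSeries ℤ (AddMonoid.End (RatFunc k)) => F.coeff (n + m) 1) (toHahn_mul f (monomial m b))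
  rw [toHahn_monomial] at h
  simp only [HahnSeries.coeff_mul_single_add] at h
  change opr q (n + m) ((f * monomial m b).coeff (n + m)) 1 =
    opr q n (f.coeff n) (opr q m b 1) at h
  simpa [opr_apply] using h

theorem coeff_monomial_mul (f : QLaurent k q) (m n : ℤ) (b : RatFunc k) :
    (monomial m b * f).coeff (n + m) = b * (qShift q ^ m) (f.coeff n) := by
  have h := congrArg (fun F : HahnSeries ℤ (AddMonoid.End (RatFunc k)) => F.coeff (n + m) 1) (toHahn_mul (monomial m b) f)
  rw [toHahn_monomial] at h
  simp only [HahnSeries.coeff_single_mul_add] at h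
  change opr q (n + m) ((monomial m b * f).coeff (n + m)) 1 =
    opr q m b (opr q n (f.coeff n) 1) at h
  simpa [opr_apply] using h

theorem coeff_smul (c : k) (f : QLaurent k q) (n : ℤ) :
    (c • f).coeff n = RatFunc.C c * f.coeff n := by
  rw [Algebra.smul_def]
  exact (exists_mul_scalar f c n).2

/-- `f = c x^a + (higher terms)`, where `c` may be zero. -/
def IsLead (f : QLaurent k q) (a : ℤ) (c : RatFunc k) : Prop :=
  (∀ i < a, f.coeff i = 0) ∧ f.coeff a = c

namespace IsLead

variable {f g : QLaurent k q} {a b : ℤ} {c d : RatFunc k}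

theorem monomial (a : ℤ) (c : RatFunc k) : IsLead (monomial a c : QLaurent k q) a c :=
  ⟨fun i hi => by rw [coeff_monomial, if_neg hi.ne], by rw [coeff_monomial, if_pos rfl]⟩

theorem one : IsLead (1 : QLaurent k q) 0 1 := monomial 0 1

theorem x : IsLead (x : QLaurent k q) 1 1 := monomial 1 1

theorem y : IsLead (y : QLaurent k q) 0 RatFunc.X := monomial 0 _

theorem add (hf : IsLead f a c) (hg : IsLead g a d) : IsLead (f + g) a (c + d) :=
  ⟨fun i hi => by rw [coeff_add, hf.1 i hi, hg.1 i hi, add_zero], by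
    rw [coeff_add, hf.2, hg.2]⟩

theorem weaken (hf : IsLead f a c) (h : b < a) : IsLead f b 0 :=
  ⟨fun i hi => hf.1 i (hi.trans h), hf.1 b h⟩

theorem smul (e : k) (hf : IsLead f a c) : IsLead (e • f) a (RatFunc.C e * c) :=
  ⟨fun i hi => by rw [coeff_smul, hf.1 i hi, mul_zero], by rw [coeff_smul, hf.2]⟩

theorem neg (hf : IsLead f a c) : IsLead (-f) a (-c) := by
  simpa using hf.smul (-1)

theorem sub (hf : IsLead f a c) (hg : IsLead g a d) : IsLead (f - g) a (c - d) := by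
  simpa [sub_eq_add_neg] using hf.add hg.neg

theorem mul (hf : IsLead f a c) (hg : IsLead g b d) :
    IsLead (f * g) (a + b) (c * (qShift q ^ a) d) := by
  refine ⟨coeff_mul_of_lt f g a b hf.1 hg.1, ?_⟩
  have := coeff_mul_of_le f g a b hf.1 hg.1 0
  simpa [hf.2, hg.2] using this

theorem ne_zero (hf : IsLead f a c) (hc : c ≠ 0) : f ≠ 0 := by
  rintro rfl
  exact hc (hf.2.symm.trans (coeff_zero a))

theorem unique (hf : IsLead f a c) (hg : IsLead f b d) (hc : c ≠ 0) (hd : d ≠ 0) :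
    a = b ∧ c = d := by
  have h : a = b := by
    rcases lt_trichotomy a b with h | h | h
    · exact absurd (hf.2.symm.trans (hg.1 a h)) hc
    · exact h
    · exact absurd (hg.2.symm.trans (hf.1 b h)) hd
  subst h
  exact ⟨rfl, hf.2.symm.trans hg.2⟩

theorem exists_of_ne_zero (hf : f ≠ 0) : ∃ a c, c ≠ 0 ∧ IsLead f a c := by
  obtain ⟨a, ha, hlt⟩ := f.exists_leading hf
  exact ⟨a, _, ha, hlt, rfl⟩

theorem inv (hf : IsLead f a c) (hc : c ≠ 0) : IsLead f⁻¹ (-a) ((qShift q ^ (-a)) c⁻¹) := by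
  have hf0 := hf.ne_zero hc
  obtain ⟨b, d, hd, hg⟩ := exists_of_ne_zero (inv_ne_zero hf0)
  have h := hf.mul hg
  rw [mul_inv_cancel₀ hf0] at h
  have hd' : (qShift q ^ a) d ≠ 0 := by rwa [Ne, EmbeddingLike.map_eq_zero_iff]
  obtain ⟨h1, h2⟩ := h.unique one (mul_ne_zero hc hd') one_ne_zero
  obtain rfl : b = -a := by omega
  have h3 : (qShift q ^ (-a)) c⁻¹ = d := by
    rw [zpow_neg]
    exact (AlgEquiv.symm_apply_eq _).2 (eq_inv_of_mul_eq_one_right h2).symm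
  rwa [h3]

end IsLead

/-! ### Conjugating `q`-commuting pairs to `x` and `y` -/

/-- Comparing coefficients of `x ^ n` gives `(q ^ n - q ^ m) y f_n = 0`, and the powers of `q` are
distinct. -/
theorem eq_monomial_of_mul_y (hq : ∀ n : ℕ, 1 ≤ n → (q : k) ^ n ≠ 1) {f : QLaurent k q} {m : ℤ}
    (h : f * y = ((q ^ m : kˣ) : k) • (y * f)) : f = monomial m (f.coeff m) := by
  ext n
  rw [coeff_monomial]
  split_ifs with hn
  · rw [hn]
  have h1 := congrArg (fun g => coeff g n) h
  have h2 := coeff_mul_monomial f 0 n RatFunc.X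
  have h3 := coeff_monomial_mul f 0 n RatFunc.X
  simp only [add_zero] at h2 h3
  change (f * monomial 0 RatFunc.X).coeff n = _ at h1
  rw [coeff_smul, h2] at h1
  change _ = _ * (monomial 0 RatFunc.X * f).coeff n at h1
  rw [h3, qShift_zpow_X] at h1
  have h4 : (RatFunc.C ((q ^ n : kˣ) : k) - RatFunc.C ((q ^ m : kˣ) : k)) *
      (RatFunc.X * f.coeff n) = 0 := by
    simp only [zpow_zero, AlgEquiv.one_apply] at h1
    linear_combination h1
  rw [← map_sub] at h4
  rcases mul_eq_zero.1 h4 with h5 | h5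
  · exfalso
    rw [map_eq_zero, sub_eq_zero] at h5
    have h6 : q ^ (n - m) = 1 := by
      rw [zpow_sub, Units.ext h5, mul_inv_cancel]
    exact hn (sub_eq_zero.1 (zpow_eq_one_of_not_root hq h6))
  · exact (mul_eq_zero.1 h5).resolve_left RatFunc.X_ne_zero

theorem exists_algebraMap_of_commute (hq : ∀ n : ℕ, 1 ≤ n → (q : k) ^ n ≠ 1) {f : QLaurent k q}
    (hx : f * x = x * f) (hy : f * y = y * f) : ∃ c : k, f = algebraMap k _ c := by
  have h0 := eq_monomial_of_mul_y hq (m := 0) (by simpa using hy)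
  have h1 : qShift q (f.coeff 0) = f.coeff 0 := by
    have h2 := congrArg (fun g => coeff g 1) hx
    have h3 := coeff_mul_monomial f 1 0 1
    have h4 := coeff_monomial_mul f 1 0 1
    simp only [zero_add, map_one, mul_one, one_mul, zpow_one] at h3 h4
    exact (h4.symm.trans h2.symm).trans h3
  obtain ⟨c, hc⟩ := exists_C_of_qShift_eq hq h1
  exact ⟨c, by rw [h0, hc]; rfl⟩

/-- The coefficients of the solution `z = 1 + ...` of `f z = z y`. -/
def conjCoeff (f : QLaurent k q) : ℕ → RatFunc k
  | n => if n = 0 then 1 else (∑ l : Fin n,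
      f.coeff ((n - l : ℕ) : ℤ) * (qShift q ^ ((n - l : ℕ) : ℤ)) (conjCoeff f l)) /
        (RatFunc.C ((q : k) ^ n - 1) * RatFunc.X)
  termination_by n => n
  decreasing_by exact l.2

/-- The coefficient of `x ^ n` in `f z = z y` reads `(q ^ n - 1) y z_n = ∑_{l < n} f_{n-l}
α^{n-l}(z_l)`. For `n = 0` it is vacuous, since `f` starts with `y`; for `n ≥ 1` it determines
`z_n`. -/
theorem exists_mul_eq_mul_y (hq : ∀ n : ℕ, 1 ≤ n → (q : k) ^ n ≠ 1) {f : QLaurent k q}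
    (hf : IsLead f 0 RatFunc.X) : ∃ z : QLaurent k q, IsLead z 0 1 ∧ f * z = z * y := by
  let z : QLaurent k q := ofNat 0 (conjCoeff f)
  have hz : ∀ i < 0, z.coeff i = 0 := fun i hi => by rw [coeff_ofNat, if_pos hi]
  have hz' : ∀ n : ℕ, z.coeff n = conjCoeff f n := fun n => by
    rw [coeff_ofNat, if_neg (by omega)]
    congr 1
  have hz0 : conjCoeff f 0 = 1 := by rw [conjCoeff, if_pos rfl]
  refine ⟨z, ⟨hz, by simpa [hz0] using hz' 0⟩, ?_⟩
  ext i
  rcases lt_or_ge i 0 with hi | hi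
  · rw [coeff_mul_of_lt f z 0 0 hf.1 hz i (by simpa using hi),
      coeff_mul_of_lt z y 0 0 hz IsLead.y.1 i (by simpa using hi)]
  obtain ⟨n, rfl⟩ := Int.eq_ofNat_of_zero_le hi
  have h1 := coeff_mul_of_le f z 0 0 hf.1 hz n
  have h2 := coeff_mul_monomial z 0 n RatFunc.X
  simp only [add_zero, zero_add] at h1 h2
  rw [h1]
  change _ = (z * monomial 0 RatFunc.X).coeff n
  rw [h2, qShift_zpow_X, hz', ← Finset.sum_range_reflect, Finset.sum_range_succ]
  have e1 : ∀ l ∈ Finset.range n, f.coeff ((n + 1 - 1 - l : ℕ) : ℤ) *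
      (qShift q ^ ((n + 1 - 1 - l : ℕ) : ℤ)) (z.coeff ((n - (n + 1 - 1 - l) : ℕ) : ℤ)) =
      f.coeff ((n - l : ℕ) : ℤ) * (qShift q ^ ((n - l : ℕ) : ℤ)) (conjCoeff f l) := by
    intro l hl
    rw [Finset.mem_range] at hl
    have : n - (n + 1 - 1 - l) = l := by omega
    rw [this, hz', Nat.add_sub_cancel]
  rw [Finset.sum_congr rfl e1]
  simp only [Nat.add_sub_cancel, Nat.sub_self, Nat.sub_zero, Nat.cast_zero, zpow_zero,
    AlgEquiv.one_apply, hf.2, hz']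
  rcases Nat.eq_zero_or_pos n with rfl | hn
  · simp [hz0]
  have hne : RatFunc.C ((q : k) ^ n - 1) * (RatFunc.X : RatFunc k) ≠ 0 :=
    mul_ne_zero ((map_ne_zero _).2 (sub_ne_zero.2 (hq n hn))) RatFunc.X_ne_zero
  have h3 := conjCoeff.eq_1 f n
  rw [if_neg hn.ne', eq_div_iff hne,
    ← Finset.sum_range (fun l => f.coeff ((n - l : ℕ) : ℤ) *
      (qShift q ^ ((n - l : ℕ) : ℤ)) (conjCoeff f l))] at h3
  rw [← h3, map_sub, map_one]
  simp only [zpow_natCast, Units.val_pow_eq_pow_val]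
  ring

/-- Once `z` conjugates `y` to `g`, the series `z⁻¹ f z` `q`-commutes with `y`, hence is a single
term `a x`, and `a = 1` by comparing leading coefficients. -/
theorem exists_conj (hq : ∀ n : ℕ, 1 ≤ n → (q : k) ^ n ≠ 1) {f g : QLaurent k q}
    (h : f * g = (q : k) • (g * f)) (hf : IsLead f 1 1) (hg : IsLead g 0 RatFunc.X) :
    ∃ z : QLaurent k q, z ≠ 0 ∧ f = z * x * z⁻¹ ∧ g = z * y * z⁻¹ := by
  obtain ⟨z, hz, e⟩ := exists_mul_eq_mul_y hq hg
  have hz0 := hz.ne_zero one_ne_zero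
  have e1 : g = z * y * z⁻¹ := by rw [← e, mul_inv_cancel_right₀ hz0]
  refine ⟨z, hz0, ?_, e1⟩
  have e2 : z⁻¹ * f * z * y = (q : k) • (y * (z⁻¹ * f * z)) := by
    have e3 : y * z⁻¹ = z⁻¹ * g := by
      rw [e1, mul_assoc z, inv_mul_cancel_left₀ hz0]
    rw [mul_assoc _ z y, ← e, mul_assoc z⁻¹, ← mul_assoc f, h, ← mul_assoc y, ← mul_assoc y, e3]
    simp only [smul_mul_assoc, mul_smul_comm, mul_assoc]
  have e4 := eq_monomial_of_mul_y hq (m := 1) (by simpa using e2)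
  have e5 := (((hz.inv one_ne_zero).mul hf).mul hz).2
  norm_num at e5
  rw [e5] at e4
  change _ = x at e4
  rw [← e4]
  simp only [mul_assoc, mul_inv_cancel_left₀ hz0, mul_inv_cancel₀ hz0, mul_one]

end QLaurent

/-- Conjugation by a nonzero element of a division algebra. -/
def conjAlgHom (k : Type*) {E : Type*} [Field k] [DivisionRing E] [Algebra k E] (z : E)
    (hz : z ≠ 0) : E →ₐ[k] E where
  toFun r := z * r * z⁻¹
  map_one' := by rw [mul_one, mul_inv_cancel₀ hz]
  map_mul' r s := by simp only [mul_assoc, inv_mul_cancel_left₀ hz]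
  map_zero' := by rw [mul_zero, zero_mul]
  map_add' r s := by rw [mul_add, add_mul]
  commutes' c := by rw [← Algebra.commutes, mul_inv_cancel_right₀ hz]

/-! ### Conjugation maps of `D` and the composite of shears -/

namespace qDivisionRing

variable {k : Type*} [Field k] {q : kˣ}

theorem isConjugationBy {θ : qDivisionRing k q →ₐ[k] qDivisionRing k q} {z : QLaurent k q}
    (hz : z ≠ 0) (hx : (θ (x k q) : QLaurent k q) = z * QLaurent.x * z⁻¹)
    (hy : (θ (y k q) : QLaurent k q) = z * QLaurent.y * z⁻¹) : IsConjugationBy θ z := by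
  refine ⟨hz, fun r => ?_⟩
  have : (qDivisionRing k q).val.comp θ = (conjAlgHom k z hz).comp (qDivisionRing k q).val :=
    algHom_ext hx hy
  exact DFunLike.congr_fun this r

theorem x_mul_y : x k q * y k q = (q : k) • (y k q * x k q) := Subtype.ext QLaurent.x_mul_y

theorem coe_x_ne_zero : x k q ≠ 0 := fun h => x_ne_zero (congrArg Subtype.val h)

theorem coe_y_ne_zero : y k q ≠ 0 := fun h => y_ne_zero (congrArg Subtype.val h)

theorem one_add_x_ne_zero : 1 + x k q ≠ 0 := fun h => by
  have h1 : (1 : QLaurent k q) + QLaurent.x = 0 := congrArg Subtype.val h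
  have h2 := congrArg (fun f => QLaurent.coeff f 1) h1
  simp [QLaurent.coeff_add, QLaurent.coeff_one, QLaurent.coeff_zero, QLaurent.x,
    QLaurent.coeff_monomial] at h2

theorem one_add_y_lead : QLaurent.IsLead (1 + QLaurent.y : QLaurent k q) 0 (1 + RatFunc.X) :=
  QLaurent.IsLead.one.add QLaurent.IsLead.y

theorem one_add_X_ne_zero : (1 + RatFunc.X : RatFunc k) ≠ 0 := by
  have h : (1 + RatFunc.X : RatFunc k) =
      algebraMap _ (RatFunc k) (Polynomial.X + Polynomial.C 1 : Polynomial k) := by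
    simp [add_comm]
  rw [h, Ne, map_eq_zero_iff _ (RatFunc.algebraMap_injective k)]
  exact Polynomial.X_add_C_ne_zero 1

theorem one_add_y_ne_zero : 1 + y k q ≠ 0 := fun h =>
  one_add_y_lead.ne_zero one_add_X_ne_zero (congrArg Subtype.val h)

theorem exists_algEquiv {f g : qDivisionRing k q →ₐ[k] qDivisionRing k q}
    (h1 : f (g (x k q)) = x k q) (h2 : f (g (y k q)) = y k q) (h3 : g (f (x k q)) = x k q)
    (h4 : g (f (y k q)) = y k q) :
    ∃ e : qDivisionRing k q ≃ₐ[k] qDivisionRing k q, (∀ r, e r = f r) ∧ ∀ r, e.symm r = g r :=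
  ⟨AlgEquiv.ofAlgHom f g (algHom_ext h1 h2) (algHom_ext h3 h4), fun _ => rfl, fun _ => rfl⟩

/-- The automorphism `x ↦ (1 + y) x`, `y ↦ y`. -/
theorem exists_shear_x (hq : ∀ n : ℕ, 1 ≤ n → (q : k) ^ n ≠ 1) :
    ∃ e : qDivisionRing k q ≃ₐ[k] qDivisionRing k q,
      e (x k q) = (1 + y k q) * x k q ∧ e (y k q) = y k q ∧
      e.symm (x k q) = (1 + y k q)⁻¹ * x k q ∧ e.symm (y k q) = y k q := by
  have hc : Commute (1 + y k q) (y k q) := (Commute.one_left _).add_left (Commute.refl _)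
  have key : ∀ a : qDivisionRing k q, Commute a (y k q) →
      a * x k q * y k q = (q : k) • (y k q * (a * x k q)) := fun a ha => by
    rw [mul_assoc, x_mul_y, mul_smul_comm, ← mul_assoc, ha.eq, mul_assoc]
  obtain ⟨f, hfx, hfy⟩ := exists_algHom hq ((1 + y k q) * x k q) (y k q)
    (mul_ne_zero one_add_y_ne_zero coe_x_ne_zero) coe_y_ne_zero (key _ hc)
  obtain ⟨g, hgx, hgy⟩ := exists_algHom hq ((1 + y k q)⁻¹ * x k q) (y k q)
    (mul_ne_zero (inv_ne_zero one_add_y_ne_zero) coe_x_ne_zero) coe_y_ne_zero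
    (key _ hc.inv_left₀)
  obtain ⟨e, he, he'⟩ := exists_algEquiv (f := f) (g := g)
    (by rw [hgx, map_mul, map_inv₀, map_add, map_one, hfx, hfy,
      inv_mul_cancel_left₀ one_add_y_ne_zero])
    (by rw [hgy, hfy])
    (by rw [hfx, map_mul, map_add, map_one, hgx, hgy, mul_inv_cancel_left₀ one_add_y_ne_zero])
    (by rw [hfy, hgy])
  exact ⟨e, by rw [he, hfx], by rw [he, hfy], by rw [he', hgx], by rw [he', hgy]⟩

/-- The automorphism `x ↦ x`, `y ↦ (1 + x) y`. -/
theorem exists_shear_y (hq : ∀ n : ℕ, 1 ≤ n → (q : k) ^ n ≠ 1) :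
    ∃ e : qDivisionRing k q ≃ₐ[k] qDivisionRing k q,
      e (x k q) = x k q ∧ e (y k q) = (1 + x k q) * y k q := by
  have hc : Commute (1 + x k q) (x k q) := (Commute.one_left _).add_left (Commute.refl _)
  have key : ∀ a : qDivisionRing k q, Commute a (x k q) →
      x k q * (a * y k q) = (q : k) • (a * y k q * x k q) := fun a ha => by
    rw [← mul_assoc, ← ha.eq, mul_assoc, x_mul_y, mul_smul_comm, ← mul_assoc]
  obtain ⟨f, hfx, hfy⟩ := exists_algHom hq (x k q) ((1 + x k q) * y k q) coe_x_ne_zero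
    (mul_ne_zero one_add_x_ne_zero coe_y_ne_zero) (key _ hc)
  obtain ⟨g, hgx, hgy⟩ := exists_algHom hq (x k q) ((1 + x k q)⁻¹ * y k q) coe_x_ne_zero
    (mul_ne_zero (inv_ne_zero one_add_x_ne_zero) coe_y_ne_zero) (key _ hc.inv_left₀)
  obtain ⟨e, he, -⟩ := exists_algEquiv (f := f) (g := g)
    (by rw [hgx, hfx])
    (by rw [hgy, map_mul, map_inv₀, map_add, map_one, hfx, hfy,
      inv_mul_cancel_left₀ one_add_x_ne_zero])
    (by rw [hfx, hgx])
    (by rw [hfy, map_mul, map_add, map_one, hgx, hgy, mul_inv_cancel_left₀ one_add_x_ne_zero])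
  exact ⟨e, by rw [he, hfx], by rw [he, hfy]⟩

/-- The degree in `x` is invariant under conjugation in `D`, as one sees in `k_{1/q}(y)((x))` by
means of `x ↦ x⁻¹`, `y ↦ y`. -/
theorem not_conj_one_add_x_pow (hq : ∀ n : ℕ, 1 ≤ n → (q : k) ^ n ≠ 1) {n : ℕ} (hn : n ≠ 0)
    {u : qDivisionRing k q} (hu : u ≠ 0) : u * y k q ≠ (1 + x k q) ^ n * y k q * u := by
  intro h
  have hx0 : (QLaurent.x : QLaurent k q⁻¹) ≠ 0 := x_ne_zero
  obtain ⟨f, hfx, hfy⟩ := exists_algHom hq (QLaurent.x⁻¹ : QLaurent k q⁻¹) QLaurent.y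
    (inv_ne_zero hx0) y_ne_zero (by
      have e : (QLaurent.y * QLaurent.x : QLaurent k q⁻¹) =
          (q : k) • (QLaurent.x * QLaurent.y) := by
        rw [QLaurent.x_mul_y, smul_smul, Units.mul_inv, one_smul]
      refine mul_left_cancel₀ hx0 (mul_right_cancel₀ hx0 ?_)
      rw [mul_inv_cancel_left₀ hx0, e]
      simp only [mul_smul_comm, smul_mul_assoc, mul_assoc, inv_mul_cancel₀ hx0, mul_one])
  have h1 := congrArg f h
  simp only [map_mul, map_pow, map_add, map_one, hfx, hfy] at h1
  obtain ⟨a, c, hc, hl⟩ := QLaurent.IsLead.exists_of_ne_zero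
    ((map_ne_zero_iff f f.toRingHom.injective).2 hu)
  -- The image of `1 + x` has order `-1`, so the two sides of the equation have orders `a` and `a -
  -- n`.
  have hb : QLaurent.IsLead (1 + QLaurent.x⁻¹ : QLaurent k q⁻¹) (-1) 1 := by
    simpa using (QLaurent.IsLead.one.weaken (b := -1) (by norm_num)).add
      ((QLaurent.IsLead.x (k := k) (q := q⁻¹)).inv one_ne_zero)
  have hp : QLaurent.IsLead ((1 + QLaurent.x⁻¹ : QLaurent k q⁻¹) ^ n) (-n) 1 := by
    clear h h1 hn
    induction n with
    | zero => simpa using QLaurent.IsLead.one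
    | succ n ih =>
      rw [pow_succ]
      have := ih.mul hb
      simp only [map_one, mul_one] at this
      convert this using 1
      push_cast
      ring
  have hL := hl.mul QLaurent.IsLead.y
  rw [h1] at hL
  have hR := (hp.mul QLaurent.IsLead.y).mul hl
  have hX : ∀ m : ℤ, (qShift q⁻¹ ^ m) (RatFunc.X : RatFunc k) ≠ 0 := fun m => by
    rw [Ne, EmbeddingLike.map_eq_zero_iff]
    exact RatFunc.X_ne_zero
  have hc' : ∀ m : ℤ, (qShift q⁻¹ ^ m) c ≠ 0 := fun m => by
    rwa [Ne, EmbeddingLike.map_eq_zero_iff]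
  have := (hL.unique hR (mul_ne_zero hc (hX _))
    (mul_ne_zero (mul_ne_zero one_ne_zero (hX _)) (hc' _))).1
  omega

theorem exists_conjugation_no_power_mem (hq : ∀ n : ℕ, 1 ≤ n → (q : k) ^ n ≠ 1) :
    ∃ (z : QLaurent k q) (θ : qDivisionRing k q →ₐ[k] qDivisionRing k q),
      IsConjugationBy θ z ∧ Function.Bijective θ ∧
      (∀ n : ℕ, 1 ≤ n → z ^ n ∉ qDivisionRing k q) ∧
      ∃ h₁ h₂ h₃ : qDivisionRing k q ≃ₐ[k] qDivisionRing k q,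
        (h₁ (x k q) : QLaurent k q) = (1 + QLaurent.y) * QLaurent.x ∧
        h₁ (y k q) = y k q ∧
        h₂ (x k q) = x k q ∧
        (h₂ (y k q) : QLaurent k q) = (1 + QLaurent.x) * QLaurent.y ∧
        (h₃ (x k q) : QLaurent k q) = (1 + QLaurent.y)⁻¹ * QLaurent.x ∧
        h₃ (y k q) = y k q ∧
        ∀ r : qDivisionRing k q, θ r = h₃ (h₂ (h₁ r)) := by
  obtain ⟨h₁, h1x, h1y, h3x, h3y⟩ := exists_shear_x hq
  obtain ⟨h₂, h2x, h2y⟩ := exists_shear_y hq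
  let e : qDivisionRing k q ≃ₐ[k] qDivisionRing k q := (h₁.trans h₂).trans h₁.symm
  have hθx : e (x k q) = (1 + (1 + (1 + y k q)⁻¹ * x k q) * y k q) *
      ((1 + y k q)⁻¹ * x k q) := by
    change h₁.symm (h₂ (h₁ (x k q))) = _
    rw [h1x, map_mul, map_mul, map_add, map_add, map_one, map_one, h2x, h2y, map_mul, map_add,
      map_one, h3x, h3y]
  have hθy : e (y k q) = (1 + (1 + y k q)⁻¹ * x k q) * y k q := by
    change h₁.symm (h₂ (h₁ (y k q))) = _
    rw [h1y, h2y, map_mul, map_add, map_one, h3x, h3y]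
  have hi := one_add_y_lead (k := k) (q := q) |>.inv one_add_X_ne_zero
  have hi' := hi.mul QLaurent.IsLead.x
  simp only [neg_zero, zpow_zero, AlgEquiv.one_apply, zero_add, mul_one] at hi'
  have hly : QLaurent.IsLead (e (y k q) : QLaurent k q) 0 RatFunc.X := by
    rw [hθy]
    change QLaurent.IsLead ((1 + (1 + QLaurent.y)⁻¹ * QLaurent.x) * QLaurent.y) _ _
    simpa using (QLaurent.IsLead.one.add (hi'.weaken (b := 0) (by norm_num))).mul
      QLaurent.IsLead.y
  have hlx : QLaurent.IsLead (e (x k q) : QLaurent k q) 1 1 := by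
    rw [hθx]
    rw [hθy] at hly
    change QLaurent.IsLead ((1 + _) * ((1 + QLaurent.y)⁻¹ * QLaurent.x)) _ _
    have := (QLaurent.IsLead.one.add hly).mul hi'
    simpa [one_add_X_ne_zero] using this
  obtain ⟨z, hz0, hzx, hzy⟩ := QLaurent.exists_conj hq
    (congrArg Subtype.val (show e (x k q) * e (y k q) = (q : k) • (e (y k q) * e (x k q)) by
      rw [← map_mul, ← map_mul, ← map_smul, x_mul_y])) hlx hly
  have hconj : IsConjugationBy (e : qDivisionRing k q →ₐ[k] qDivisionRing k q) z :=
    isConjugationBy hz0 hzx hzy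
  refine ⟨z, e, hconj, e.bijective, fun n hn hmem => ?_, h₁, h₂, h₁.symm, congrArg Subtype.val h1x,
    h1y, h2x, congrArg Subtype.val h2y, congrArg Subtype.val h3x, h3y, fun r => rfl⟩
  have hpow : ∀ n : ℕ, ((e^[n] (y k q) : qDivisionRing k q) : QLaurent k q) * z ^ n =
      z ^ n * QLaurent.y := by
    intro n
    induction n with
    | zero => simp [y]
    | succ n ih =>
      have h1 := hconj.2 (e^[n] (y k q))
      rw [Function.iterate_succ_apply', pow_succ']
      change ((e (e^[n] (y k q)) : qDivisionRing k q) : QLaurent k q) = _ at h1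
      rw [h1, mul_assoc (z * _), inv_mul_cancel_left₀ hz0, mul_assoc, ih, mul_assoc]
  -- Since `h₁` fixes `y`, applying `h₁` to `e ^ n (y)` amounts to computing `h₂ ^ n (y)`, and `h₂`
  -- fixes `1 + x`.
  have hsem : ∀ n : ℕ, h₁ (e^[n] (y k q)) = (1 + x k q) ^ n * y k q := by
    intro n
    induction n with
    | zero => simp [h1y]
    | succ n ih =>
      rw [Function.iterate_succ_apply']
      change h₁ (h₁.symm (h₂ (h₁ _))) = _
      rw [AlgEquiv.apply_symm_apply, ih, map_mul, map_pow, map_add, map_one, h2x, h2y, pow_succ,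
        mul_assoc]
  have hw : (⟨z ^ n, hmem⟩ : qDivisionRing k q) ≠ 0 := fun h =>
    pow_ne_zero n hz0 (congrArg Subtype.val h)
  have h1 : e^[n] (y k q) * ⟨z ^ n, hmem⟩ = ⟨z ^ n, hmem⟩ * y k q := Subtype.ext (hpow n)
  have h2 := congrArg h₁ h1
  rw [map_mul, map_mul, hsem, h1y] at h2
  exact not_conj_one_add_x_pow hq (by omega) ((map_ne_zero_iff h₁ h₁.injective).2 hw) h2.symm

end qDivisionRing

/-! ### Algebraic identities for the involution -/

section Identities

variable {k E : Type*} [Field k] [DivisionRing E] [Algebra k E]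

theorem mul_inv_of_qComm {c : k} (hc : c ≠ 0) {m y : E} (hy : y ≠ 0)
    (h : m * y = c • (y * m)) : m * y⁻¹ = c⁻¹ • (y⁻¹ * m) := by
  refine mul_right_cancel₀ hy ?_
  rw [inv_mul_cancel_right₀ hy, smul_mul_assoc, mul_assoc, h, mul_smul_comm,
    inv_mul_cancel_left₀ hy, inv_smul_smul₀ hc]

/-- The two products differ only in the mixed terms `y m y⁻¹ = c⁻¹ m` and `y⁻¹ m y = c m`. The
constant is symmetric in `c` and `c⁻¹`, so one identity serves both `x` and its image under the
involution. -/
theorem add_inv_mul_add_inv {c : k} (hc : c ≠ 0) {m y : E} (hy : y ≠ 0)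
    (h : m * y = c • (y * m)) : (y + y⁻¹) * m * (y + y⁻¹) =
      (y - y⁻¹) * m * (y - y⁻¹) + (2 * (c + c⁻¹)) • m := by
  have h' := mul_inv_of_qComm hc hy h
  simp only [add_mul, mul_add, sub_mul, mul_sub, mul_assoc, h, h', mul_smul_comm,
    mul_inv_cancel_left₀ hy, inv_mul_cancel_left₀ hy]
  module

theorem add_inv_mul_self {y : E} (hy : y ≠ 0) :
    (y + y⁻¹) * (y + y⁻¹) = (y - y⁻¹) * (y - y⁻¹) + algebraMap k E 4 := by
  simp only [add_mul, mul_add, sub_mul, mul_sub, mul_inv_cancel₀ hy, inv_mul_cancel₀ hy]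
  rw [map_ofNat, show (4 : E) = 1 + 1 + 1 + 1 by norm_num]
  abel

theorem mul_mul_of_mul_left {c : k} {w v h : E} (hw : w ≠ 0) (hc : w * v = v * w)
    (e : w * (w * h) * w = v * (w * h) * v + c • (w * h)) : w * h * w = v * h * v + c • h := by
  refine mul_left_cancel₀ hw ?_
  rw [mul_add, mul_smul_comm, ← mul_assoc w (w * h) w, e, ← mul_assoc v w h, ← hc]
  simp only [mul_assoc]

theorem mul_add_mul {c : k} {w v a b : E} (ha : w * a * w = v * a * v + c • a)
    (hb : w * b * w = v * b * v + c • b) :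
    w * (a + b) * w = v * (a + b) * v + c • (a + b) := by
  rw [mul_add, mul_add, add_mul, add_mul, ha, hb]
  module

theorem add_inv_mul_sub_inv {y : E} : (y + y⁻¹) * (y - y⁻¹) = (y - y⁻¹) * (y + y⁻¹) := by
  rcases eq_or_ne y 0 with rfl | hy
  · simp
  simp only [add_mul, mul_add, sub_mul, mul_sub, mul_inv_cancel₀ hy, inv_mul_cancel₀ hy]
  noncomm_ring

/-- Elements `f` (the image of `x` under the involution), `h` and `G` with
`x = G + y⁻¹ h` and `f = G - y h`. -/
structure IsFold (q : kˣ) (x y f h G : E) : Prop where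
  y_ne : y ≠ 0
  w_ne : y + y⁻¹ ≠ 0
  xy : x * y = (q : k) • (y * x)
  fy : f * y = (q : k)⁻¹ • (y * f)
  fx : f * x = y⁻¹ - (q : k)⁻¹ • y
  xf : x * f = (q : k)⁻¹ • y⁻¹ - y
  x_eq : x = G + y⁻¹ * h
  f_eq : f = G - y * h

namespace IsFold

variable {q : kˣ} {x y f h G : E}

theorem w_mul_h (H : IsFold q x y f h G) : (y + y⁻¹) * h = x - f := by
  rw [H.x_eq, H.f_eq]
  noncomm_ring

theorem w_mul_G (H : IsFold q x y f h G) : (y + y⁻¹) * G = y * x + y⁻¹ * f := by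
  rw [H.x_eq, H.f_eq, mul_add, mul_sub, mul_inv_cancel_left₀ H.y_ne,
    inv_mul_cancel_left₀ H.y_ne]
  noncomm_ring

theorem f_mul_inv (H : IsFold q x y f h G) : f * y⁻¹ = (q : k) • (y⁻¹ * f) := by
  simpa using mul_inv_of_qComm (inv_ne_zero q.ne_zero) H.y_ne H.fy

/-- Multiplied by `w = y + y⁻¹`, the left side is `(x - f) G`. Writing `G = f + y h` after `x` and
`G = x - y⁻¹ h` after `f` gives `x f - f x + q (y x + y⁻¹ f) h`, where `y x + y⁻¹ f = w G` and `x f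
- f x = (q⁻¹ - 1) w`. -/
theorem h_mul_G (H : IsFold q x y f h G) :
    h * G = (q : k) • (G * h) + ((q : k)⁻¹ - 1) • (1 : E) := by
  refine mul_left_cancel₀ H.w_ne ?_
  have e1 : x * (y * h) = (q : k) • (y * (x * h)) := by
    rw [← mul_assoc, H.xy, smul_mul_assoc, mul_assoc]
  have e2 : f * (y⁻¹ * h) = (q : k) • (y⁻¹ * (f * h)) := by
    rw [← mul_assoc, H.f_mul_inv, smul_mul_assoc, mul_assoc]
  have e3 : x * G = x * f + x * (y * h) := by rw [← mul_add, H.f_eq, sub_add_cancel]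
  have e4 : f * G = f * x - f * (y⁻¹ * h) := by rw [← mul_sub, H.x_eq, add_sub_cancel_right]
  rw [mul_add, ← mul_assoc, H.w_mul_h, mul_smul_comm, ← mul_assoc, H.w_mul_G, sub_mul, e3, e4,
    e1, e2, H.xf, H.fx, add_mul, mul_smul_comm, mul_one, mul_assoc, mul_assoc]
  module

/-- The shift by `q⁻¹` is the one that absorbs the constant term of `h_mul_G`. -/
theorem h_mul_Y (H : IsFold q x y f h G) :
    h * (G * h - (q : k)⁻¹ • 1) = (q : k) • ((G * h - (q : k)⁻¹ • 1) * h) := by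
  rw [mul_sub, ← mul_assoc, H.h_mul_G, add_mul, sub_mul, smul_mul_assoc, smul_mul_assoc,
    smul_mul_assoc, mul_smul_comm, smul_sub, smul_smul, mul_inv_cancel₀ q.ne_zero, mul_one,
    one_mul]
  module

/-- This places `y - y⁻¹` in the division ring generated over `k` by `h` and `G h - q⁻¹`. The method
is that of `h_mul_G`: multiply by `y + y⁻¹` and reduce to the products `x f` and `f x`. -/
theorem v_mul_Y (H : IsFold q x y f h G) :
    (y - y⁻¹) * (G * h - (q : k)⁻¹ • 1) = (q : k)⁻¹ • (G * G) - h * h := by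
  refine mul_left_cancel₀ H.w_ne ?_
  have hc : (y + y⁻¹) * (y - y⁻¹) = (y - y⁻¹) * (y + y⁻¹) := add_inv_mul_sub_inv
  have e1 : x * (y * h) = (q : k) • (y * (x * h)) := by
    rw [← mul_assoc, H.xy, smul_mul_assoc, mul_assoc]
  have e2 : f * (y⁻¹ * h) = (q : k) • (y⁻¹ * (f * h)) := by
    rw [← mul_assoc, H.f_mul_inv, smul_mul_assoc, mul_assoc]
  have e3 : x * G = (q : k)⁻¹ • y⁻¹ - y + (q : k) • (y * (x * h)) := by
    rw [← e1, ← H.xf, ← mul_add, H.f_eq, sub_add_cancel]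
  have e4 : f * G = y⁻¹ - (q : k)⁻¹ • y - (q : k) • (y⁻¹ * (f * h)) := by
    rw [← e2, ← H.fx, ← mul_sub, H.x_eq, add_sub_cancel_right]
  have l : (y + y⁻¹) * ((y - y⁻¹) * (G * h - (q : k)⁻¹ • 1)) =
      (y - y⁻¹) * ((y + y⁻¹) * G * h) - (q : k)⁻¹ • ((y - y⁻¹) * (y + y⁻¹)) := by
    rw [← mul_assoc, hc, mul_sub, mul_smul_comm, mul_one]
    simp only [mul_assoc]
  have r : (y + y⁻¹) * ((q : k)⁻¹ • (G * G) - h * h) =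
      (q : k)⁻¹ • ((y + y⁻¹) * G * G) - (y + y⁻¹) * h * h := by
    rw [mul_sub, mul_smul_comm, mul_assoc, mul_assoc]
  rw [l, r, H.w_mul_G, H.w_mul_h]
  simp only [add_mul, mul_add, sub_mul, mul_sub, mul_assoc, e3, e4, mul_smul_comm,
    mul_inv_cancel₀ H.y_ne, inv_mul_cancel₀ H.y_ne, mul_inv_cancel_left₀ H.y_ne,
    inv_mul_cancel_left₀ H.y_ne, smul_add, smul_sub, smul_smul, inv_mul_cancel₀ q.ne_zero,
    one_smul]
  module

theorem w_mul_h_mul_w (H : IsFold q x y f h G) : (y + y⁻¹) * h * (y + y⁻¹) =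
    (y - y⁻¹) * h * (y - y⁻¹) + (2 * ((q : k) + (q : k)⁻¹)) • h := by
  refine mul_mul_of_mul_left H.w_ne add_inv_mul_sub_inv ?_
  rw [H.w_mul_h, sub_eq_add_neg]
  refine mul_add_mul (add_inv_mul_add_inv q.ne_zero H.y_ne H.xy) ?_
  have := add_inv_mul_add_inv (m := -f) (inv_ne_zero q.ne_zero) H.y_ne
    (by rw [neg_mul, H.fy, mul_neg, smul_neg])
  rwa [inv_inv, add_comm (q : k)⁻¹] at this

theorem w_mul_G_mul_w (H : IsFold q x y f h G) : (y + y⁻¹) * G * (y + y⁻¹) =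
    (y - y⁻¹) * G * (y - y⁻¹) + (2 * ((q : k) + (q : k)⁻¹)) • G := by
  refine mul_mul_of_mul_left H.w_ne add_inv_mul_sub_inv ?_
  rw [H.w_mul_G]
  refine mul_add_mul (add_inv_mul_add_inv q.ne_zero H.y_ne
    (by rw [mul_assoc, H.xy, mul_smul_comm])) ?_
  have := add_inv_mul_add_inv (m := y⁻¹ * f) (inv_ne_zero q.ne_zero) H.y_ne (by
    rw [mul_assoc, H.fy, mul_smul_comm, inv_mul_cancel_left₀ H.y_ne, mul_inv_cancel_left₀ H.y_ne])
  rwa [inv_inv, add_comm (q : k)⁻¹] at this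

end IsFold

end Identities

/-! ### Quadratic extensions by a normalizing element -/

/-- If `w` normalizes the division ring `F` and `w ^ 2 ∈ F`, then `F + F w` is a division ring. -/
def Subfield.addMulNormalizer {E : Type*} [DivisionRing E] (F : Subfield E) (w : E) (hw : w ≠ 0)
    (hww : w * w ∈ F) (hF : ∀ a ∈ F, w * a * w⁻¹ ∈ F) : Subfield E where
  carrier := {r | ∃ a ∈ F, ∃ b ∈ F, r = a + b * w}
  zero_mem' := ⟨0, zero_mem _, 0, zero_mem _, by simp⟩
  one_mem' := ⟨1, one_mem _, 0, zero_mem _, by simp⟩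
  add_mem' := by
    rintro _ _ ⟨a, ha, b, hb, rfl⟩ ⟨c, hc, d, hd, rfl⟩
    exact ⟨a + c, add_mem ha hc, b + d, add_mem hb hd, by noncomm_ring⟩
  neg_mem' := by
    rintro _ ⟨a, ha, b, hb, rfl⟩
    exact ⟨-a, neg_mem ha, -b, neg_mem hb, by noncomm_ring⟩
  mul_mem' := by
    rintro _ _ ⟨a, ha, b, hb, rfl⟩ ⟨c, hc, d, hd, rfl⟩
    refine ⟨a * c + b * (w * d * w⁻¹) * (w * w),
      add_mem (mul_mem ha hc) (mul_mem (mul_mem hb (hF d hd)) hww),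
      a * d + b * (w * c * w⁻¹), add_mem (mul_mem ha hd) (mul_mem hb (hF c hc)), ?_⟩
    simp only [add_mul, mul_add, mul_assoc, inv_mul_cancel_left₀ hw, inv_mul_cancel₀ hw, mul_one]
    abel
  inv_mem' := by
    rintro _ ⟨a, ha, b, hb, rfl⟩
    rcases eq_or_ne a 0 with rfl | ha0
    · refine ⟨0, zero_mem _, (w * w)⁻¹ * (w * b⁻¹ * w⁻¹),
        mul_mem (inv_mem hww) (hF _ (inv_mem hb)), ?_⟩
      rw [zero_add, zero_add, mul_inv_rev, mul_inv_rev]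
      simp only [mul_assoc, inv_mul_cancel₀ hw, inv_mul_cancel_left₀ hw, mul_one]
    have hc : a⁻¹ * b ∈ F := mul_mem (inv_mem ha) hb
    -- Multiplying by the conjugate factor `1 - a⁻¹ b w` removes the `w`-component, which leaves a
    -- norm `N ∈ F`. The factor vanishes only when `b w = a`, and then the element is `a + a ∈ F`.
    have key : (a + b * w) * (1 - a⁻¹ * b * w) =
        a - b * (w * (a⁻¹ * b) * w⁻¹) * (w * w) := by
      simp only [add_mul, mul_sub, mul_assoc, inv_mul_cancel_left₀ hw, mul_one,
        mul_inv_cancel_left₀ ha0]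
      abel
    have hN : a - b * (w * (a⁻¹ * b) * w⁻¹) * (w * w) ∈ F :=
      sub_mem ha (mul_mem (mul_mem hb (hF _ hc)) hww)
    set N := a - b * (w * (a⁻¹ * b) * w⁻¹) * (w * w)
    rcases eq_or_ne (1 - a⁻¹ * b * w) 0 with h0 | h0
    · have h1 : b * w = a := by
        have := congrArg (fun t => a * t) (sub_eq_zero.1 h0)
        simp only [mul_one, mul_assoc, mul_inv_cancel_left₀ ha0] at this
        exact this.symm
      exact ⟨(a + a)⁻¹, inv_mem (add_mem ha ha), 0, zero_mem _, by rw [h1]; simp⟩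
    · rcases eq_or_ne (a + b * w) 0 with h1 | h1
      · exact ⟨0, zero_mem _, 0, zero_mem _, by simp [h1]⟩
      have hN0 : N ≠ 0 := key ▸ mul_ne_zero h1 h0
      refine ⟨N⁻¹, inv_mem hN, -(a⁻¹ * b * (w * N⁻¹ * w⁻¹)),
        neg_mem (mul_mem hc (hF _ (inv_mem hN))), ?_⟩
      refine inv_eq_of_mul_eq_one_right ?_
      have e : N⁻¹ + -(a⁻¹ * b * (w * N⁻¹ * w⁻¹)) * w = (1 - a⁻¹ * b * w) * N⁻¹ := by
        simp only [sub_mul, neg_mul, one_mul, mul_assoc, inv_mul_cancel₀ hw, mul_one]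
        abel
      rw [e, ← mul_assoc, key, mul_inv_cancel₀ hN0]

theorem QLaurent.IsLead.of_eq {k : Type*} [Field k] {q : kˣ} {f g : QLaurent k q} {a b : ℤ}
    {c d : RatFunc k} (hf : IsLead f a c) (hfg : f = g) (hab : a = b) (hcd : c = d) :
    IsLead g b d := by
  subst hfg hab hcd
  exact hf

/-! ### The involution of the `q`-division ring -/

theorem C_mul_X_sq_add_C_ne_zero {k : Type*} [Field k] {a : k} (ha : a ≠ 0) (b : k) :
    RatFunc.C a * RatFunc.X ^ 2 + RatFunc.C b ≠ 0 := by
  have h : RatFunc.C a * RatFunc.X ^ 2 + RatFunc.C b = algebraMap _ (RatFunc k)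
      (Polynomial.C a * Polynomial.X ^ 2 + Polynomial.C b : Polynomial k) := by
    simp
  rw [h, Ne, map_eq_zero_iff _ (RatFunc.algebraMap_injective k)]
  intro h0
  have := congrArg (fun p => Polynomial.coeff p 2) h0
  simp [ha] at this

theorem X_add_X_inv_ne_zero {k : Type*} [Field k] : (RatFunc.X + RatFunc.X⁻¹ : RatFunc k) ≠ 0 := by
  intro h
  have := C_mul_X_sq_add_C_ne_zero (k := k) one_ne_zero 1
  rw [map_one] at this
  apply this
  have hX := RatFunc.X_ne_zero (K := k)
  field_simp at h
  rw [one_mul, h, mul_zero]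

theorem X_inv_sub_C_mul_X_ne_zero {k : Type*} [Field k] {a : k} (ha : a ≠ 0) :
    (RatFunc.X⁻¹ - RatFunc.C a * RatFunc.X : RatFunc k) ≠ 0 := by
  intro h
  have := C_mul_X_sq_add_C_ne_zero (neg_ne_zero.2 ha) 1
  rw [map_one, map_neg] at this
  apply this
  have hX := RatFunc.X_ne_zero (K := k)
  field_simp at h
  linear_combination h

namespace qDivisionRing

variable {k : Type*} [Field k] {q : kˣ}

open QLaurent (IsLead)

theorem y_inv_lead : IsLead (QLaurent.y⁻¹ : QLaurent k q) 0 RatFunc.X⁻¹ := by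
  simpa using IsLead.y.inv (q := q) RatFunc.X_ne_zero

theorem w_lead :
    IsLead (QLaurent.y + QLaurent.y⁻¹ : QLaurent k q) 0 (RatFunc.X + RatFunc.X⁻¹) :=
  IsLead.y.add y_inv_lead

theorem w_ne_zero : y k q + (y k q)⁻¹ ≠ 0 := fun h =>
  w_lead.ne_zero X_add_X_inv_ne_zero (congrArg Subtype.val h)

theorem g_lead : IsLead (QLaurent.y⁻¹ - (q : k)⁻¹ • QLaurent.y : QLaurent k q) 0
    (RatFunc.X⁻¹ - RatFunc.C (q : k)⁻¹ * RatFunc.X) :=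
  y_inv_lead.sub (IsLead.y.smul _)

theorem g_ne_zero : (y k q)⁻¹ - (q : k)⁻¹ • y k q ≠ 0 := fun h =>
  g_lead.ne_zero (X_inv_sub_C_mul_X_ne_zero (inv_ne_zero q.ne_zero)) (congrArg Subtype.val h)

/-- The pair `(f, -y⁻¹)` with `f = (y⁻¹ - q⁻¹ y) x⁻¹` `q`-commutes, which gives `φ`. Moreover `φ(y⁻¹
- q⁻¹ y) = q⁻¹ y⁻¹ - y = x f`, so `φ(f) = x f f⁻¹ = x`. Since `φ` negates `x - f`, `y x + y⁻¹ f` and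
`y + y⁻¹`, it fixes the quotients `h` and `G`. -/
theorem exists_involution (hq : ∀ n : ℕ, 1 ≤ n → (q : k) ^ n ≠ 1) :
    ∃ (φ : qDivisionRing k q ≃ₐ[k] qDivisionRing k q) (h G : qDivisionRing k q),
      φ (x k q) = ((y k q)⁻¹ - (q : k)⁻¹ • y k q) * (x k q)⁻¹ ∧ φ (y k q) = -(y k q)⁻¹ ∧
      (∀ r, φ (φ r) = r) ∧ φ h = h ∧ φ G = G ∧ IsFold q (x k q) (y k q) (φ (x k q)) h G := by
  have hx := coe_x_ne_zero (k := k) (q := q)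
  have hy := coe_y_ne_zero (k := k) (q := q)
  have hw := w_ne_zero (k := k) (q := q)
  have hg := g_ne_zero (k := k) (q := q)
  have hxy := x_mul_y (k := k) (q := q)
  have hxi := mul_inv_of_qComm q.ne_zero hy hxy
  set a := x k q
  set b := y k q
  have hxy' : a⁻¹ * b = (q : k)⁻¹ • (b * a⁻¹) := by
    refine mul_left_cancel₀ hx (mul_right_cancel₀ hx ?_)
    rw [mul_inv_cancel_left₀ hx, mul_smul_comm, smul_mul_assoc, ← mul_assoc, hxy,
      smul_mul_assoc, smul_mul_assoc, inv_smul_smul₀ q.ne_zero, inv_mul_cancel_right₀ hx]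
  have hgb : (b⁻¹ - (q : k)⁻¹ • b) * b = b * (b⁻¹ - (q : k)⁻¹ • b) := by
    rw [sub_mul, mul_sub, smul_mul_assoc, mul_smul_comm, mul_inv_cancel₀ hy, inv_mul_cancel₀ hy]
  set g := b⁻¹ - (q : k)⁻¹ • b with hgdef
  have hfy : g * a⁻¹ * b = (q : k)⁻¹ • (b * (g * a⁻¹)) := by
    rw [mul_assoc, hxy', mul_smul_comm, ← mul_assoc, hgb, mul_assoc]
  have hfyi : g * a⁻¹ * b⁻¹ = (q : k) • (b⁻¹ * (g * a⁻¹)) := by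
    simpa using mul_inv_of_qComm (inv_ne_zero q.ne_zero) hy hfy
  have hxg : a * g = ((q : k)⁻¹ • b⁻¹ - b) * a := by
    rw [hgdef, mul_sub, hxi, mul_smul_comm, hxy, inv_smul_smul₀ q.ne_zero, sub_mul,
      smul_mul_assoc]
  have hxf : a * (g * a⁻¹) = (q : k)⁻¹ • b⁻¹ - b := by
    rw [← mul_assoc, hxg, mul_inv_cancel_right₀ hx]
  have hfx : g * a⁻¹ * a = g := inv_mul_cancel_right₀ hx _
  have hf : g * a⁻¹ ≠ 0 := mul_ne_zero hg (inv_ne_zero hx)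
  obtain ⟨φ, hφx, hφy⟩ := exists_algHom hq (g * a⁻¹) (-b⁻¹) hf (neg_ne_zero.2 (inv_ne_zero hy))
    (by rw [mul_neg, hfyi, neg_mul, smul_neg])
  have hφb : φ b⁻¹ = -b := by rw [map_inv₀, hφy, inv_neg, inv_inv]
  have hφφy : φ (φ b) = b := by rw [hφy, map_neg, hφb, neg_neg]
  have hφf : φ (g * a⁻¹) = a := by
    rw [map_mul, map_inv₀, hφx, hgdef, map_sub, map_smul, hφb, hφy, smul_neg, sub_neg_eq_add,
      ← hgdef, neg_add_eq_sub, ← hxf, mul_inv_cancel_right₀ hf]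
  have hφφx : φ (φ a) = a := by rw [hφx, hφf]
  obtain ⟨e, he, -⟩ := exists_algEquiv (f := φ) (g := φ) hφφx hφφy hφφx hφφy
  have hφw : φ (b + b⁻¹)⁻¹ = -(b + b⁻¹)⁻¹ := by
    rw [map_inv₀, map_add, hφb, hφy, ← neg_add_rev, inv_neg]
  have hcomm : (b + b⁻¹)⁻¹ * b = b * (b + b⁻¹)⁻¹ :=
    (((Commute.refl b).add_left (Commute.refl b).inv_left₀).inv_left₀).eq
  have hcomm' : (b + b⁻¹)⁻¹ * b⁻¹ = b⁻¹ * (b + b⁻¹)⁻¹ :=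
    (((Commute.refl b).inv_right₀.add_left (Commute.refl b⁻¹)).inv_left₀).eq
  refine ⟨e, (b + b⁻¹)⁻¹ * (a - g * a⁻¹), (b + b⁻¹)⁻¹ * (b * a + b⁻¹ * (g * a⁻¹)),
    by rw [he, hφx], by rw [he, hφy], fun r => ?_, ?_, ?_, hy, hw, hxy, ?_, ?_, ?_, ?_, ?_⟩
  · have : φ.comp φ = AlgHom.id k _ := algHom_ext hφφx hφφy
    rw [he, he]
    exact DFunLike.congr_fun this r
  · rw [he, map_mul, hφw, map_sub, hφx, hφf, neg_mul, ← mul_neg, neg_sub]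
  · rw [he, map_mul, hφw, map_add, map_mul, map_mul, hφx, hφf, hφy, hφb, neg_mul, ← mul_neg,
      neg_mul, neg_mul, neg_add, neg_neg, neg_neg, add_comm (b⁻¹ * _)]
  · rw [he, hφx, hfy]
  · rw [he, hφx, hfx]
  · rw [he, hφx, hxf]
  · refine mul_left_cancel₀ hw ?_
    rw [← mul_assoc b⁻¹ (b + b⁻¹)⁻¹, ← hcomm', mul_assoc _ b⁻¹, ← mul_add, mul_inv_cancel_left₀ hw]
    noncomm_ring
  · refine mul_left_cancel₀ hw ?_
    rw [he, hφx, ← mul_assoc b (b + b⁻¹)⁻¹, ← hcomm, mul_assoc _ b (_ - _), ← mul_sub,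
      mul_inv_cancel_left₀ hw]
    noncomm_ring

variable {f h G : qDivisionRing k q}

theorem f_lead (hf : f = ((y k q)⁻¹ - (q : k)⁻¹ • y k q) * (x k q)⁻¹) :
    IsLead (f : QLaurent k q) (-1) (RatFunc.X⁻¹ - RatFunc.C (q : k)⁻¹ * RatFunc.X) := by
  rw [hf]
  exact (g_lead.mul (IsLead.x.inv (q := q) one_ne_zero)).of_eq rfl rfl (by simp)

theorem h_lead (hf : f = ((y k q)⁻¹ - (q : k)⁻¹ • y k q) * (x k q)⁻¹)
    (H : IsFold q (x k q) (y k q) f h G) :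
    IsLead (h : QLaurent k q) (-1) (-((RatFunc.X + RatFunc.X⁻¹)⁻¹ *
      (RatFunc.X⁻¹ - RatFunc.C (q : k)⁻¹ * RatFunc.X))) := by
  have e : h = (y k q + (y k q)⁻¹)⁻¹ * (x k q - f) := by
    rw [← H.w_mul_h, inv_mul_cancel_left₀ H.w_ne]
  rw [e]
  have := (w_lead.inv (q := q) X_add_X_inv_ne_zero).mul
    ((IsLead.x.weaken (b := -1) (by norm_num)).sub (f_lead hf))
  exact this.of_eq rfl (by norm_num) (by
    simp only [neg_zero, zpow_zero, AlgEquiv.one_apply]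
    ring)

theorem G_lead (hf : f = ((y k q)⁻¹ - (q : k)⁻¹ • y k q) * (x k q)⁻¹)
    (H : IsFold q (x k q) (y k q) f h G) :
    IsLead (G : QLaurent k q) (-1) (((RatFunc.X + RatFunc.X⁻¹)⁻¹ *
      (RatFunc.X⁻¹ - RatFunc.C (q : k)⁻¹ * RatFunc.X)) * RatFunc.X⁻¹) := by
  have e : G = (y k q + (y k q)⁻¹)⁻¹ * (y k q * x k q + (y k q)⁻¹ * f) := by
    rw [← H.w_mul_G, inv_mul_cancel_left₀ H.w_ne]
  rw [e]
  have := (w_lead.inv (q := q) X_add_X_inv_ne_zero).mul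
    (((IsLead.y.mul IsLead.x).weaken (b := -1) (by norm_num)).add (y_inv_lead.mul (f_lead hf)))
  refine this.of_eq rfl (by norm_num) ?_
  simp only [neg_zero, zpow_zero, AlgEquiv.one_apply, zero_add]
  ring

theorem lead_ne_zero : (RatFunc.X + RatFunc.X⁻¹ : RatFunc k)⁻¹ *
      (RatFunc.X⁻¹ - RatFunc.C (q : k)⁻¹ * RatFunc.X) ≠ 0 :=
  mul_ne_zero (inv_ne_zero X_add_X_inv_ne_zero)
    (X_inv_sub_C_mul_X_ne_zero (inv_ne_zero q.ne_zero))

/-- The leading term of `Y = G h - q⁻¹`. -/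
theorem Y_lead (hf : f = ((y k q)⁻¹ - (q : k)⁻¹ • y k q) * (x k q)⁻¹)
    (H : IsFold q (x k q) (y k q) f h G) : ∃ c : RatFunc k, c ≠ 0 ∧
      IsLead ((G * h - (q : k)⁻¹ • 1 : qDivisionRing k q) : QLaurent k q) (-2)
        (c * RatFunc.X⁻¹) ∧ IsLead ((h * h : qDivisionRing k q) : QLaurent k q) (-2) (-c) := by
  set A := (RatFunc.X + RatFunc.X⁻¹ : RatFunc k)⁻¹ *
      (RatFunc.X⁻¹ - RatFunc.C (q : k)⁻¹ * RatFunc.X) with hA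
  have hA0 : A ≠ 0 := lead_ne_zero
  have hA1 : (qShift q ^ (-1 : ℤ)) A ≠ 0 := by rwa [Ne, EmbeddingLike.map_eq_zero_iff]
  have h1 := (G_lead hf H).mul (h_lead hf H)
  have h2 := (h_lead hf H).mul (h_lead hf H)
  rw [← hA] at h1 h2
  -- The shared factor `c` is what makes `h h Y⁻¹` start with `-X`.
  refine ⟨-(A * (qShift q ^ (-1 : ℤ)) A), neg_ne_zero.2 (mul_ne_zero hA0 hA1), ?_, ?_⟩
  · have h3 := h1.sub ((IsLead.one.smul (q : k)⁻¹).weaken (b := -1 + -1) (by norm_num))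
    refine h3.of_eq rfl (by norm_num) ?_
    rw [map_neg]
    ring
  · refine h2.of_eq rfl (by norm_num) ?_
    rw [map_neg]
    ring

end qDivisionRing

theorem inv_mul_of_qComm {k E : Type*} [Field k] [DivisionRing E] [Algebra k E] {c : k}
    (hc : c ≠ 0) {m y : E} (hm : m ≠ 0) (h : m * y = c • (y * m)) :
    m⁻¹ * y = c⁻¹ • (y * m⁻¹) := by
  refine mul_right_cancel₀ hm ?_
  rw [smul_mul_assoc, inv_mul_cancel_right₀ hm]
  refine mul_left_cancel₀ hm ?_
  rw [mul_assoc, mul_inv_cancel_left₀ hm, mul_smul_comm, h, inv_smul_smul₀ hc]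

theorem qShift_zpow_apply_neg {k : Type*} [Field k] {q : kˣ} (a : ℤ) (c : RatFunc k) :
    (qShift q ^ a) ((qShift q ^ (-a)) c) = c := by
  rw [← AlgEquiv.mul_apply, ← zpow_add, add_neg_cancel, zpow_zero, AlgEquiv.one_apply]

namespace qDivisionRing

variable {k : Type*} [Field k] {q : kˣ}

open QLaurent (IsLead)

/-! ### A conjugation map that is not surjective -/

/-- Shifting the leading coefficient of `h` by `α` gives `(X² - q⁻¹) / (q X² + q⁻¹)`. The first two
factors are this fraction, so they normalize the leading coefficient of `h⁻¹` to 1. -/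
theorem lead_mul_lead : (RatFunc.X * RatFunc.X - RatFunc.C (q : k)⁻¹ * 1) *
    (RatFunc.C (q : k) * (RatFunc.X * RatFunc.X) + RatFunc.C (q : k)⁻¹ * 1)⁻¹ *
    qShift q (-((RatFunc.X + RatFunc.X⁻¹)⁻¹ *
      (RatFunc.X⁻¹ - RatFunc.C (q : k)⁻¹ * RatFunc.X)))⁻¹ = 1 := by
  have hX := RatFunc.X_ne_zero (K := k)
  have hp : RatFunc.C (q : k) ≠ 0 := (map_ne_zero _).2 q.ne_zero
  have hC : ∀ c : k, qShift q (RatFunc.C c) = RatFunc.C c := (qShift q).commutes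
  have hN := C_mul_X_sq_add_C_ne_zero q.ne_zero (q : k)⁻¹
  have hM := C_mul_X_sq_add_C_ne_zero (k := k) one_ne_zero (-(q : k)⁻¹)
  rw [map_one, map_neg, one_mul, ← sub_eq_add_neg] at hM
  simp only [map_inv₀, map_neg, map_mul, map_add, map_sub, qShift_X, hC] at hN hM ⊢
  set p := RatFunc.C (q : k)
  set t := (RatFunc.X : RatFunc k)
  have e1 : p * t + (p * t)⁻¹ = (p * t ^ 2 + p⁻¹) / t := by field_simp
  have e2 : (p * t)⁻¹ - p⁻¹ * (p * t) = -(t ^ 2 - p⁻¹) / t := by field_simp; ring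
  rw [e1, e2, mul_one, ← pow_two]
  generalize p * t ^ 2 + p⁻¹ = N at *
  generalize t ^ 2 - p⁻¹ = M at *
  field_simp

theorem exists_conjugation_not_surjective (hq : ∀ n : ℕ, 1 ≤ n → (q : k) ^ n ≠ 1) :
    ∃ (z : QLaurent k q) (θ : qDivisionRing k q →ₐ[k] qDivisionRing k q),
      IsConjugationBy θ z ∧ ¬ Function.Surjective θ := by
  obtain ⟨φ, h, G, hφx, hφy, -, hφh, hφG, H⟩ := exists_involution hq
  have hhl := h_lead hφx H
  obtain ⟨c, hc, hYl, hhhl⟩ := Y_lead hφx H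
  have hcX : c * RatFunc.X⁻¹ ≠ 0 := mul_ne_zero hc (inv_ne_zero RatFunc.X_ne_zero)
  have hh0 : h ≠ 0 := fun e => hhl.ne_zero (neg_ne_zero.2 lead_ne_zero) (congrArg Subtype.val e)
  have hY0 : G * h - (q : k)⁻¹ • 1 ≠ 0 := fun e => hYl.ne_zero hcX (congrArg Subtype.val e)
  have hφY : φ (G * h - (q : k)⁻¹ • 1) = G * h - (q : k)⁻¹ • 1 := by
    rw [map_sub, map_mul, hφG, hφh, map_smul, map_one]
  have hhY := H.h_mul_Y
  set Y := G * h - (q : k)⁻¹ • (1 : qDivisionRing k q)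
  have hTl : IsLead ((-(h * h * Y⁻¹) : qDivisionRing k q) : QLaurent k q) 0 RatFunc.X := by
    refine (hhhl.mul (hYl.inv hcX)).neg.of_eq rfl (by norm_num) ?_
    rw [qShift_zpow_apply_neg, mul_inv, inv_inv]
    field_simp
  have hhT : h * -(h * h * Y⁻¹) = (q : k)⁻¹ • (-(h * h * Y⁻¹) * h) := by
    have e : h * (h * h * Y⁻¹) = h * h * (h * Y⁻¹) := by simp only [mul_assoc]
    rw [mul_neg, neg_mul, smul_neg, e, mul_inv_of_qComm q.ne_zero hY0 hhY, mul_smul_comm,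
      mul_assoc (h * h)]
  have hT0 : -(h * h * Y⁻¹) ≠ 0 :=
    neg_ne_zero.2 (mul_ne_zero (mul_ne_zero hh0 hh0) (inv_ne_zero hY0))
  have hφT : φ (-(h * h * Y⁻¹)) = -(h * h * Y⁻¹) := by
    rw [map_neg, map_mul, map_mul, map_inv₀, hφh, hφY]
  -- `T` plays the role of `y`: it is fixed by `φ`, starts with `y`, and `h⁻¹ T = q T h⁻¹`. It
  -- remains to normalize `h⁻¹` by a function of `T`, which does not disturb this relation; `N` and
  -- `M` below are the polynomials of `lead_mul_lead` evaluated at `T`.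
  set T := -(h * h * Y⁻¹)
  have hNl : IsLead ((T * T - (q : k)⁻¹ • 1 : qDivisionRing k q) : QLaurent k q) 0
      (RatFunc.X * RatFunc.X - RatFunc.C (q : k)⁻¹ * 1) :=
    ((hTl.mul hTl).sub (IsLead.one.smul (q : k)⁻¹)).of_eq rfl rfl (by simp)
  have hMl : IsLead (((q : k) • (T * T) + (q : k)⁻¹ • 1 : qDivisionRing k q) : QLaurent k q) 0
      (RatFunc.C (q : k) * (RatFunc.X * RatFunc.X) + RatFunc.C (q : k)⁻¹ * 1) :=
    (((hTl.mul hTl).smul (q : k)).add (IsLead.one.smul (q : k)⁻¹)).of_eq rfl rfl (by simp)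
  have hM : RatFunc.C (q : k) * (RatFunc.X * RatFunc.X) + RatFunc.C (q : k)⁻¹ * 1 ≠ 0 := by
    have := C_mul_X_sq_add_C_ne_zero q.ne_zero (q : k)⁻¹
    rwa [pow_two, ← mul_one (RatFunc.C (q : k)⁻¹)] at this
  set N := T * T - (q : k)⁻¹ • (1 : qDivisionRing k q) with hN
  set M := (q : k) • (T * T) + (q : k)⁻¹ • (1 : qDivisionRing k q) with hM'
  have hSl : IsLead ((N * M⁻¹ * h⁻¹ : qDivisionRing k q) : QLaurent k q) 1 1 := by
    have := (hNl.mul (hMl.inv hM)).mul (hhl.inv (neg_ne_zero.2 lead_ne_zero))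
    refine this.of_eq rfl (by norm_num) ?_
    simp only [neg_zero, add_zero, zpow_zero, AlgEquiv.one_apply, neg_neg, zpow_one]
    exact lead_mul_lead
  have hS0 : N * M⁻¹ * h⁻¹ ≠ 0 := fun e => hSl.ne_zero one_ne_zero (congrArg Subtype.val e)
  have hNT : Commute N T :=
    ((Commute.refl T).mul_left (Commute.refl T)).sub_left ((Commute.one_left T).smul_left _)
  have hMT : Commute M T :=
    (((Commute.refl T).mul_left (Commute.refl T)).smul_left _).add_left
      ((Commute.one_left T).smul_left _)
  have hST : N * M⁻¹ * h⁻¹ * T = (q : k) • (T * (N * M⁻¹ * h⁻¹)) := by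
    have := inv_mul_of_qComm (inv_ne_zero q.ne_zero) hh0 hhT
    rw [inv_inv] at this
    rw [mul_assoc (N * M⁻¹), this, mul_smul_comm, ← mul_assoc, (hNT.mul_left hMT.inv_left₀).eq,
      mul_assoc]
  have hφS : φ (N * M⁻¹ * h⁻¹) = N * M⁻¹ * h⁻¹ := by
    simp only [hN, hM', map_mul, map_inv₀, map_sub, map_add, map_smul, map_one, hφT, hφh]
  obtain ⟨θ, hθx, hθy⟩ := exists_algHom hq _ _ hS0 hT0 hST
  obtain ⟨z, hz0, hzx, hzy⟩ := QLaurent.exists_conj hq (congrArg Subtype.val hST) hSl hTl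
  refine ⟨z, θ, isConjugationBy hz0 (by rw [hθx]; exact hzx) (by rw [hθy]; exact hzy),
    fun hsurj => ?_⟩
  -- The image of `θ` lies in the fixed ring of `φ`, whereas `φ(y) = -y⁻¹ ≠ y`.
  have hfix : (φ : qDivisionRing k q →ₐ[k] qDivisionRing k q).comp θ = θ :=
    algHom_ext ((congrArg φ hθx).trans (hφS.trans hθx.symm))
      ((congrArg φ hθy).trans (hφT.trans hθy.symm))
  obtain ⟨r, hr⟩ := hsurj (y k q)
  have h1 : φ (θ r) = θ r := DFunLike.congr_fun hfix r
  rw [hr, hφy] at h1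
  exact H.w_ne (by rw [← sub_neg_eq_add, h1, sub_self])

/-! ### A conjugation map whose square is inner -/

section Fixed

variable [CharZero k] {f h G : qDivisionRing k q}

/-- With `F` the image of `ι`, the set `F + F w` is a division ring, because `w² ∈ F` and `w`
normalizes `F`. It contains `y = (v + w) / 2` and `x = G + y⁻¹ h`, hence is all of `D`. -/
theorem exists_add_mul_w (H : IsFold q (x k q) (y k q) f h G)
    (hh0 : h ≠ 0) (hY0 : G * h - (q : k)⁻¹ • 1 ≠ 0)
    {ι : qDivisionRing k q →ₐ[k] qDivisionRing k q} (hιx : ι (x k q) = h)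
    (hιy : ι (y k q) = G * h - (q : k)⁻¹ • 1) (r : qDivisionRing k q) :
    ∃ a b, r = ι a + ι b * (y k q + (y k q)⁻¹) := by
  set w := y k q + (y k q)⁻¹ with hw
  set Y := G * h - (q : k)⁻¹ • (1 : qDivisionRing k q) with hY
  let F : Subfield (qDivisionRing k q) := (ι : qDivisionRing k q →+* qDivisionRing k q).fieldRange
  have hk : ∀ c : k, algebraMap k _ c ∈ F := fun c => ⟨algebraMap k _ c, ι.commutes c⟩
  have hsmul : ∀ (c : k), ∀ a ∈ F, c • a ∈ F := fun c a ha => by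
    rw [Algebra.smul_def]; exact mul_mem (hk c) ha
  have hhF : h ∈ F := ⟨x k q, hιx⟩
  have hYF : Y ∈ F := ⟨y k q, hιy⟩
  have hGF : G ∈ F := by
    have : G = (Y + (q : k)⁻¹ • 1) * h⁻¹ := by
      rw [hY, sub_add_cancel, mul_inv_cancel_right₀ hh0]
    rw [this]
    exact mul_mem (add_mem hYF (hsmul _ _ (one_mem _))) (Subfield.inv_mem _ hhF)
  have hvF : y k q - (y k q)⁻¹ ∈ F := by
    have : y k q - (y k q)⁻¹ = ((q : k)⁻¹ • (G * G) - h * h) * Y⁻¹ := by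
      rw [← H.v_mul_Y, mul_inv_cancel_right₀ hY0]
    rw [this]
    exact mul_mem (sub_mem (hsmul _ _ (mul_mem hGF hGF)) (mul_mem hhF hhF)) (Subfield.inv_mem _ hYF)
  have hwwF : w * w ∈ F := by
    rw [hw, add_inv_mul_self (k := k) H.y_ne]
    exact add_mem (mul_mem hvF hvF) (hk 4)
  -- As `w² ∈ F`, it suffices to treat `w m w`, which for `m = h, G` equals `v m v + c m` with `v`
  -- and `c` in `F`.
  have hconj : ∀ m, w * m * w ∈ F → w * m * w⁻¹ ∈ F := fun m h1 => by
    have : w * m * w⁻¹ = w * m * w * (w * w)⁻¹ := by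
      rw [mul_inv_rev, ← mul_assoc, mul_inv_cancel_right₀ H.w_ne]
    rw [this]
    exact mul_mem h1 (Subfield.inv_mem _ hwwF)
  have hwh : w * h * w⁻¹ ∈ F := hconj h (by
    rw [H.w_mul_h_mul_w]
    exact add_mem (mul_mem (mul_mem hvF hhF) hvF) (hsmul _ _ hhF))
  have hwG : w * G * w⁻¹ ∈ F := hconj G (by
    rw [H.w_mul_G_mul_w]
    exact add_mem (mul_mem (mul_mem hvF hGF) hvF) (hsmul _ _ hGF))
  have hwY : conjAlgHom k w H.w_ne Y ∈ F := by
    rw [hY, map_sub, map_mul, map_smul, map_one]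
    exact sub_mem (mul_mem hwG hwh) (hsmul _ _ (one_mem _))
  have hF : ∀ a ∈ F, w * a * w⁻¹ ∈ F := by
    rintro _ ⟨a, rfl⟩
    let κ : qDivisionRing k q →ₐ[k] qDivisionRing k q := (conjAlgHom k w H.w_ne).comp ι
    refine mem_of_generators (F.comap (κ : qDivisionRing k q →+* qDivisionRing k q))
      (fun c => ⟨algebraMap k _ c, (ι.commutes c).trans (κ.commutes c).symm⟩) ?_ ?_ a
    · change w * ι (x k q) * w⁻¹ ∈ F
      rwa [hιx]
    · change conjAlgHom k w H.w_ne (ι (y k q)) ∈ F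
      rwa [hιy]
  let B := F.addMulNormalizer w H.w_ne hwwF hF
  have hFB : ∀ a ∈ F, a ∈ B := fun a ha => ⟨a, ha, 0, zero_mem _, by simp⟩
  have hwB : w ∈ B := ⟨0, zero_mem _, 1, one_mem _, by simp⟩
  have hyB : y k q ∈ B := by
    have : y k q = algebraMap k _ 2⁻¹ * ((y k q - (y k q)⁻¹) + w) := by
      rw [← Algebra.smul_def, hw]
      have : y k q - (y k q)⁻¹ + (y k q + (y k q)⁻¹) = (2 : k) • y k q := by
        rw [two_smul]; abel
      rw [this, inv_smul_smul₀ two_ne_zero]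
    rw [this]
    exact mul_mem (hFB _ (hk _)) (add_mem (hFB _ hvF) hwB)
  have hxB : x k q ∈ B := by
    rw [H.x_eq]
    exact add_mem (hFB _ hGF) (mul_mem (Subfield.inv_mem _ hyB) (hFB _ hhF))
  obtain ⟨_, ⟨a, rfl⟩, _, ⟨b, rfl⟩, e⟩ := mem_of_generators B (fun c => hFB _ (hk c)) hxB hyB r
  exact ⟨a, b, e⟩

end Fixed

theorem conj_quotient {E : Type*} [DivisionRing E] [Algebra k E] {V m s : E} {c d : k}
    (hV : V ≠ 0) (hs : s = (V * m * V + c • m) * (V * V + algebraMap k E d)⁻¹) :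
    V⁻¹ * s * V = (m + c • (V⁻¹ * m * V⁻¹)) * (1 + d • (V⁻¹ * V⁻¹))⁻¹ := by
  have h1 : 1 + d • (V⁻¹ * V⁻¹) = V⁻¹ * (V * V + algebraMap k E d) * V⁻¹ := by
    rw [mul_add, add_mul, inv_mul_cancel_left₀ hV, mul_inv_cancel₀ hV, ← Algebra.commutes,
      mul_assoc, ← Algebra.smul_def]
  rw [h1, mul_inv_rev, mul_inv_rev, inv_inv, hs]
  simp only [add_mul, mul_add, smul_mul_assoc, mul_smul_comm, mul_assoc,
    inv_mul_cancel_left₀ hV]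

/-- As `V⁻¹` has positive order, the terms `V⁻¹ m V⁻¹` and `V⁻¹ V⁻¹` in `conj_quotient` do not
affect the leading term of `m`. -/
theorem conj_quotient_lead {V m s : QLaurent k q} {c d : k} {a : ℤ} {e r : RatFunc k}
    (he : e ≠ 0) (hV : IsLead V (-2) e) (hm : IsLead m a r)
    (hs : s = (V * m * V + c • m) * (V * V + algebraMap k _ d)⁻¹) :
    IsLead (V⁻¹ * s * V) a r := by
  rw [conj_quotient (hV.ne_zero he) hs]
  have hVi : IsLead V⁻¹ 1 0 := (hV.inv he).weaken (by norm_num)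
  have h1 : IsLead (m + c • (V⁻¹ * m * V⁻¹)) a r :=
    (hm.add ((((hVi.mul hm).mul hVi).smul c).weaken (b := a) (by omega))).of_eq rfl rfl
      (add_zero r)
  have h2 : IsLead (1 + d • (V⁻¹ * V⁻¹)) 0 1 :=
    (IsLead.one.add (((hVi.mul hVi).smul d).weaken (b := 0) (by norm_num))).of_eq rfl rfl
      (add_zero 1)
  exact (h1.mul (h2.inv one_ne_zero)).of_eq rfl (by norm_num) (by simp)

end qDivisionRing

namespace qDivisionRing

variable {k : Type*} [Field k] {q : kˣ}

open QLaurent (IsLead)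

theorem conj_mul_conj {E : Type*} [DivisionRing E] {V a b : E} (hV : V ≠ 0) :
    V⁻¹ * a * V * (V⁻¹ * b * V) = V⁻¹ * (a * b) * V := by
  simp only [mul_assoc, mul_inv_cancel_left₀ hV]

theorem exists_conjugation_sq_mem [CharZero k] (hq : ∀ n : ℕ, 1 ≤ n → (q : k) ^ n ≠ 1) :
    ∃ (z : QLaurent k q) (θ : qDivisionRing k q →ₐ[k] qDivisionRing k q),
      IsConjugationBy θ z ∧ Function.Bijective θ ∧ z ∉ qDivisionRing k q ∧
      z ^ 2 ∈ qDivisionRing k q ∧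
      ∃ φ : qDivisionRing k q ≃ₐ[k] qDivisionRing k q,
        (φ (x k q) : QLaurent k q) =
          (QLaurent.y⁻¹ - (q : k)⁻¹ • QLaurent.y) * QLaurent.x⁻¹ ∧
        (φ (y k q) : QLaurent k q) = -QLaurent.y⁻¹ ∧
        (∀ r, φ (φ r) = r) ∧
        ∃ ι : qDivisionRing k q ≃ₐ[k] fixedRing φ,
          ∀ r : qDivisionRing k q,
            ((ι (θ r) : qDivisionRing k q) : QLaurent k q) =
              (QLaurent.y + QLaurent.y⁻¹) * ((ι r : qDivisionRing k q) : QLaurent k q) *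
                (QLaurent.y + QLaurent.y⁻¹)⁻¹ := by
  obtain ⟨φ, h, G, hφx, hφy, hφφ, hφh, hφG, H⟩ := exists_involution hq
  obtain ⟨c, hc, hYl, -⟩ := Y_lead hφx H
  have hh0 : h ≠ 0 := fun e =>
    (h_lead hφx H).ne_zero (neg_ne_zero.2 lead_ne_zero) (congrArg Subtype.val e)
  have hY0 : G * h - (q : k)⁻¹ • 1 ≠ 0 := fun e =>
    hYl.ne_zero (mul_ne_zero hc (inv_ne_zero RatFunc.X_ne_zero)) (congrArg Subtype.val e)
  obtain ⟨ι, hιx, hιy⟩ := exists_algHom hq h _ hh0 hY0 H.h_mul_Y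
  have hdec := exists_add_mul_w H hh0 hY0 hιx hιy
  have hinj : Function.Injective ι := ι.toRingHom.injective
  have hφι : ∀ r, φ (ι r) = ι r := fun r => by
    have : (φ : qDivisionRing k q →ₐ[k] qDivisionRing k q).comp ι = ι := by
      refine algHom_ext ?_ ?_
      · change φ (ι _) = _
        rw [hιx, hφh]
      · change φ (ι _) = _
        rw [hιy, map_sub, map_mul, hφG, hφh, map_smul, map_one]
    exact DFunLike.congr_fun this r
  have hφw : φ (y k q + (y k q)⁻¹) = -(y k q + (y k q)⁻¹) := by
    rw [map_add, map_inv₀, hφy, inv_neg, inv_inv, neg_add_rev]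
  have hww : (y k q + (y k q)⁻¹) * (y k q + (y k q)⁻¹) =
      (y k q - (y k q)⁻¹) * (y k q - (y k q)⁻¹) + algebraMap k _ 4 := add_inv_mul_self H.y_ne
  have hwh := H.w_mul_h_mul_w
  have hwG := H.w_mul_G_mul_w
  have hw := H.w_ne
  have hneg : ∀ r : qDivisionRing k q, r = -r → r = 0 := fun r hr => by
    have h2 : (2 : k) • r = 0 := by
      rw [two_smul]
      nth_rewrite 2 [hr]
      rw [add_neg_cancel]
    exact (smul_eq_zero.1 h2).resolve_left two_ne_zero
  have hv : y k q - (y k q)⁻¹ =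
      ((q : k)⁻¹ • (G * G) - h * h) * (G * h - (q : k)⁻¹ • 1)⁻¹ := by
    rw [← H.v_mul_Y, mul_inv_cancel_right₀ hY0]
  -- the isomorphism onto the fixed ring
  have hsurj : ∀ r, φ r = r → ∃ a, ι a = r := fun r hr => by
    obtain ⟨a, b, e⟩ := hdec r
    -- `φ` fixes `ι a` and negates `ι b * w`, so an element fixed by `φ` has no `w`-component, as `2
    -- ≠ 0`.
    have h1 : ι b * (y k q + (y k q)⁻¹) = 0 := by
      refine hneg _ ?_
      rw [e, map_add, map_mul, hφι, hφι, hφw, mul_neg] at hr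
      exact (add_left_cancel hr).symm
    exact ⟨a, by rw [e, h1, add_zero]⟩
  let ιe : qDivisionRing k q ≃ₐ[k] fixedRing φ :=
    AlgEquiv.ofBijective (ι.codRestrict (fixedRing φ) hφι)
      ⟨fun a b hab => hinj (congrArg Subtype.val hab), fun r => by
        obtain ⟨a, ha⟩ := hsurj r r.2
        exact ⟨a, Subtype.ext ha⟩⟩
  set w := y k q + (y k q)⁻¹ with hwdef
  let κ : qDivisionRing k q →ₐ[k] qDivisionRing k q := (conjAlgHom k w hw).comp ι
  have hκ : ∀ r, κ r ∈ fixedRing φ := fun r => by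
    change φ (w * ι r * w⁻¹) = w * ι r * w⁻¹
    rw [map_mul, map_mul, map_inv₀, hφw, hφι, inv_neg, neg_mul, neg_mul, mul_neg, neg_neg]
  let θ : qDivisionRing k q →ₐ[k] qDivisionRing k q :=
    (ιe.symm : fixedRing φ →ₐ[k] qDivisionRing k q).comp (κ.codRestrict (fixedRing φ) hκ)
  have hθ : ∀ r, ι (θ r) = w * ι r * w⁻¹ := fun r =>
    congrArg Subtype.val (ιe.apply_symm_apply (κ.codRestrict (fixedRing φ) hκ r))
  have hθbij : Function.Bijective θ := by
    refine ⟨θ.toRingHom.injective, fun s => ?_⟩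
    obtain ⟨a, ha⟩ := hsurj (w⁻¹ * ι s * w) (by
      rw [map_mul, map_mul, map_inv₀, hφw, hφι, inv_neg, neg_mul, neg_mul, mul_neg, neg_neg])
    refine ⟨a, hinj ?_⟩
    rw [hθ, ha]
    simp only [mul_assoc, mul_inv_cancel₀ hw, mul_inv_cancel_left₀ hw, mul_one]
  -- the leading terms of `θ`
  obtain ⟨G', hG'⟩ : ∃ G', G' = (y k q + (q : k)⁻¹ • 1) * (x k q)⁻¹ := ⟨_, rfl⟩
  obtain ⟨V, hV⟩ : ∃ V, V = ((q : k)⁻¹ • (G' * G') - x k q * x k q) * (y k q)⁻¹ := ⟨_, rfl⟩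
  -- `G'` and `V` are the preimages of `G` and `y - y⁻¹` under `ι`, read off from `Y = G h - q⁻¹`
  -- and `v_mul_Y`.
  have hιG' : ι G' = G := by
    rw [hG', map_mul, map_inv₀, map_add, map_smul, map_one, hιx, hιy, sub_add_cancel,
      mul_inv_cancel_right₀ hh0]
  have hιV : ι V = y k q - (y k q)⁻¹ := by
    rw [hV, map_mul, map_inv₀, map_sub, map_smul, map_mul, map_mul, hιx, hιy, hιG', hv]
  have hG'l : IsLead (G' : QLaurent k q) (-1) (RatFunc.X + RatFunc.C (q : k)⁻¹) := by
    rw [hG']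
    exact ((IsLead.y.add (IsLead.one.smul (q : k)⁻¹)).mul
      (IsLead.x.inv one_ne_zero)).of_eq rfl (by norm_num) (by simp)
  have hXc : (RatFunc.X + RatFunc.C (q : k)⁻¹ : RatFunc k) ≠ 0 := by
    have e : (RatFunc.X + RatFunc.C (q : k)⁻¹ : RatFunc k) = algebraMap _ (RatFunc k)
        (Polynomial.X + Polynomial.C (q : k)⁻¹ : Polynomial k) := by simp
    rw [e, Ne, map_eq_zero_iff _ (RatFunc.algebraMap_injective k)]
    exact Polynomial.X_add_C_ne_zero _
  obtain ⟨e, he, hVl⟩ : ∃ e, e ≠ 0 ∧ IsLead (V : QLaurent k q) (-2) e := by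
    have h1 := ((hG'l.mul hG'l).smul (q : k)⁻¹).sub
      ((IsLead.x.mul IsLead.x).weaken (b := -1 + -1) (by norm_num))
    have h2 := h1.mul (IsLead.y.inv RatFunc.X_ne_zero)
    have hne : ∀ (n : ℤ) (a : RatFunc k), a ≠ 0 → (qShift q ^ n) a ≠ 0 := fun n a ha => by
      rwa [Ne, EmbeddingLike.map_eq_zero_iff]
    refine ⟨_, ?_, h2.of_eq (by rw [hV]; rfl) (by norm_num) rfl⟩
    rw [sub_zero]
    exact mul_ne_zero (mul_ne_zero ((map_ne_zero _).2 (inv_ne_zero q.ne_zero))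
      (mul_ne_zero hXc (hne _ _ hXc))) (hne _ _ (hne _ _ (inv_ne_zero RatFunc.X_ne_zero)))
  have hV0 : (V : QLaurent k q) ≠ 0 := hVl.ne_zero he
  have hww' : ∀ m : qDivisionRing k q, w * m * w⁻¹ = w * m * w * (w * w)⁻¹ := fun m => by
    rw [mul_inv_rev, ← mul_assoc, mul_inv_cancel_right₀ hw]
  have hθx : θ (x k q) = (V * x k q * V + (2 * ((q : k) + (q : k)⁻¹)) • x k q) *
      (V * V + algebraMap k _ 4)⁻¹ := hinj (by
    rw [hθ, hww', map_mul, map_inv₀, map_add, map_add, map_mul, map_mul, map_mul, map_smul, hιV,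
      hιx, AlgHom.commutes, hwh, hww])
  have hθG' : θ G' = (V * G' * V + (2 * ((q : k) + (q : k)⁻¹)) • G') *
      (V * V + algebraMap k _ 4)⁻¹ := hinj (by
    rw [hθ, hww', map_mul, map_inv₀, map_add, map_add, map_mul, map_mul, map_mul, map_smul, hιV,
      hιG', AlgHom.commutes, hwG, hww])
  have hθy : θ (y k q) = θ G' * θ (x k q) - (q : k)⁻¹ • 1 := by
    have : y k q = G' * x k q - (q : k)⁻¹ • 1 := by
      rw [hG', inv_mul_cancel_right₀ coe_x_ne_zero, add_sub_cancel_right]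
    rw [← map_mul, ← map_one θ, ← map_smul, ← map_sub, ← this]
  have hlx := conj_quotient_lead he hVl IsLead.x (congrArg Subtype.val hθx)
  have hlG := conj_quotient_lead he hVl hG'l (congrArg Subtype.val hθG')
  -- From `y = G' x - q⁻¹` the leading coefficient is `(X + q⁻¹) - q⁻¹ = X`. Thus `θ` followed by
  -- the inner automorphism `r ↦ V⁻¹ r V` meets the hypotheses of `exists_conj`.
  have hly : IsLead ((V : QLaurent k q)⁻¹ * (θ (y k q) : QLaurent k q) * (V : QLaurent k q)) 0 RatFunc.X := by
    refine ((hlG.mul hlx).sub (IsLead.one.smul (q : k)⁻¹)).of_eq ?_ rfl (by simp)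
    rw [hθy]
    change _ = (V : QLaurent k q)⁻¹ * ((θ G' : QLaurent k q) * (θ (x k q) : QLaurent k q) - (q : k)⁻¹ • 1) *
      (V : QLaurent k q)
    rw [conj_mul_conj hV0, mul_sub, sub_mul, mul_smul_comm, mul_one, smul_mul_assoc,
      inv_mul_cancel₀ hV0]
  -- the conjugating element
  have hcomm : (θ (x k q) : QLaurent k q) * (θ (y k q) : QLaurent k q) =
      (q : k) • ((θ (y k q) : QLaurent k q) * (θ (x k q) : QLaurent k q)) := by
    have h1 : θ (x k q) * θ (y k q) = (q : k) • (θ (y k q) * θ (x k q)) := by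
      rw [← map_mul, ← map_mul, ← map_smul, x_mul_y]
    exact congrArg Subtype.val h1
  obtain ⟨z, hz0, hzx, hzy⟩ := QLaurent.exists_conj hq
    (by rw [conj_mul_conj hV0, conj_mul_conj hV0, hcomm, mul_smul_comm, smul_mul_assoc]) hlx hly
  have hVz : (V : QLaurent k q) * z ≠ 0 := mul_ne_zero hV0 hz0
  have hback : ∀ s t : QLaurent k q, (V : QLaurent k q)⁻¹ * s * (V : QLaurent k q) = z * t * z⁻¹ →
      s = (V : QLaurent k q) * z * t * ((V : QLaurent k q) * z)⁻¹ := fun s t hst => by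
    rw [mul_inv_rev, mul_assoc (V : QLaurent k q) z, ← mul_assoc _ z⁻¹, mul_assoc _ _ z⁻¹, ← hst]
    simp only [mul_assoc, mul_inv_cancel_left₀ hV0, mul_inv_cancel₀ hV0, mul_one]
  have hconj : IsConjugationBy θ ((V : QLaurent k q) * z) :=
    isConjugationBy hVz (hback _ _ hzx) (hback _ _ hzy)
  set Z := (V : QLaurent k q) * z
  refine ⟨Z, θ, hconj, hθbij, fun hmem => ?_, ?_, φ, congrArg Subtype.val hφx,
    congrArg Subtype.val hφy, hφφ, ιe, fun r => congrArg Subtype.val (hθ r)⟩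
  · obtain ⟨t, ht⟩ : ∃ t : qDivisionRing k q, (t : QLaurent k q) = Z := ⟨⟨Z, hmem⟩, rfl⟩
    have ht0 : t ≠ 0 := fun h0 => hVz (by rw [← ht, h0]; rfl)
    have hιt0 : ι t ≠ 0 := (map_ne_zero_iff ι hinj).2 ht0
    have hθt : ∀ r, θ r = t * r * t⁻¹ := fun r => Subtype.ext (by
      rw [hconj.2 r, ← ht]; rfl)
    -- If `θ` were conjugation by `t ∈ D`, then `ι t` and `w` would act alike on `F`. So `s`
    -- commutes with `F` and with `w`, hence is central and a scalar; but `φ` negates it.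
    set s := (ι t)⁻¹ * w with hs
    have hsι : ∀ r, Commute s (ι r) := fun r => by
      have h1 := hθ r
      rw [hθt, map_mul, map_mul, map_inv₀] at h1
      refine mul_left_cancel₀ hιt0 (mul_right_cancel₀ (inv_ne_zero hw) ?_)
      rw [hs, mul_assoc (ι t)⁻¹, mul_inv_cancel_left₀ hιt0, ← h1, ← mul_assoc (ι r),
        ← mul_assoc (ι t), mul_assoc (ι t * (ι r * (ι t)⁻¹)), mul_inv_cancel₀ hw, mul_one,
        mul_assoc]
    have hsw : Commute s w := by
      have : w = ι t * s := by rw [hs, mul_inv_cancel_left₀ hιt0]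
      have h1 := (hsι t).mul_right (Commute.refl s)
      rwa [← this] at h1
    have hsall : ∀ r, Commute s r := fun r => by
      obtain ⟨a, b, e⟩ := hdec r
      rw [e]
      exact (hsι a).add_right ((hsι b).mul_right hsw)
    obtain ⟨d, hd⟩ := QLaurent.exists_algebraMap_of_commute hq
      (congrArg Subtype.val (hsall (x k q)).eq) (congrArg Subtype.val (hsall (y k q)).eq)
    have hd' : s = algebraMap k _ d := Subtype.ext hd
    have hφs : φ s = s := by rw [hd', AlgEquiv.commutes]
    have hφs' : φ s = -s := by rw [hs, map_mul, map_inv₀, hφι, hφw, mul_neg]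
    have hs0 : s = 0 := hneg s (hφs.symm.trans hφs')
    exact mul_ne_zero (inv_ne_zero hιt0) hw hs0
  -- `ι u = w²`, so `θ²` is conjugation both by `u ∈ D` and by `Z²`; the quotient `u⁻¹ Z²` commutes
  -- with `x` and `y` and is therefore a scalar.
  · set u := V * V + algebraMap k (qDivisionRing k q) 4 with hu
    have hιu : ι u = w * w := by
      rw [hu, map_add, map_mul, hιV, AlgHom.commutes, hww]
    have hu0 : u ≠ 0 := fun h0 => mul_ne_zero hw hw (by rw [← hιu, h0, map_zero])
    have hu0' : (u : QLaurent k q) ≠ 0 := fun h0 => hu0 (Subtype.ext h0)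
    have hθθ : ∀ r, θ (θ r) = u * r * u⁻¹ := fun r => hinj (by
      rw [hθ, hθ, map_mul, map_mul, map_inv₀, hιu, mul_inv_rev]
      simp only [mul_assoc])
    have hcom : ∀ r : qDivisionRing k q,
        ((u : QLaurent k q)⁻¹ * (Z * Z)) * r = r * ((u : QLaurent k q)⁻¹ * (Z * Z)) := by
      intro r
      have h1 : ((θ (θ r) : qDivisionRing k q) : QLaurent k q) = u * r * (u : QLaurent k q)⁻¹ :=
        congrArg Subtype.val (hθθ r)
      rw [hconj.2, hconj.2] at h1
      refine mul_left_cancel₀ hu0' (mul_right_cancel₀ (mul_ne_zero (inv_ne_zero hVz)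
        (inv_ne_zero hVz)) ?_)
      have e1 : (u : QLaurent k q) * ((u : QLaurent k q)⁻¹ * (Z * Z) * r) * (Z⁻¹ * Z⁻¹) =
          Z * (Z * r * Z⁻¹) * Z⁻¹ := by
        simp only [mul_assoc, mul_inv_cancel_left₀ hu0']
      have e2 : (u : QLaurent k q) * (r * ((u : QLaurent k q)⁻¹ * (Z * Z))) * (Z⁻¹ * Z⁻¹) =
          u * r * (u : QLaurent k q)⁻¹ := by
        simp only [mul_assoc, mul_inv_cancel_left₀ hVz, mul_inv_cancel₀ hVz, mul_one]
      rw [e1, e2, h1]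
    obtain ⟨d, hd⟩ := QLaurent.exists_algebraMap_of_commute hq (hcom (x k q)) (hcom (y k q))
    have : Z ^ 2 = u * algebraMap k _ d := by
      rw [← hd, mul_inv_cancel_left₀ hu0', pow_two]
    rw [this]
    exact mul_mem u.2 ((qDivisionRing k q).algebraMap_mem d)

end qDivisionRing

end

theorem theorem3p3p11 {k : Type*} [Field k] [CharZero k] (q : kˣ)
    (hq : ∀ n : ℕ, 1 ≤ n → (q : k) ^ n ≠ 1) :
    -- (i), first kind
    (∃ (z : QLaurent k q) (θ : qDivisionRing k q →ₐ[k] qDivisionRing k q),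
      IsConjugationBy θ z ∧ Function.Bijective θ ∧ z ∉ qDivisionRing k q ∧
      z ^ 2 ∈ qDivisionRing k q ∧
      ∃ φ : qDivisionRing k q ≃ₐ[k] qDivisionRing k q,
        (φ (qDivisionRing.x k q) : QLaurent k q) =
          (QLaurent.y⁻¹ - (q : k)⁻¹ • QLaurent.y) * QLaurent.x⁻¹ ∧
        (φ (qDivisionRing.y k q) : QLaurent k q) = -QLaurent.y⁻¹ ∧
        (∀ r, φ (φ r) = r) ∧
        ∃ ι : qDivisionRing k q ≃ₐ[k] fixedRing φ,
          ∀ r : qDivisionRing k q,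
            ((ι (θ r) : qDivisionRing k q) : QLaurent k q) =
              (QLaurent.y + QLaurent.y⁻¹) * ((ι r : qDivisionRing k q) : QLaurent k q) *
                (QLaurent.y + QLaurent.y⁻¹)⁻¹) ∧
    -- (i), second kind
    (∃ (z : QLaurent k q) (θ : qDivisionRing k q →ₐ[k] qDivisionRing k q),
      IsConjugationBy θ z ∧ Function.Bijective θ ∧
      (∀ n : ℕ, 1 ≤ n → z ^ n ∉ qDivisionRing k q) ∧
      ∃ h₁ h₂ h₃ : qDivisionRing k q ≃ₐ[k] qDivisionRing k q,
        (h₁ (qDivisionRing.x k q) : QLaurent k q) = (1 + QLaurent.y) * QLaurent.x ∧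
        h₁ (qDivisionRing.y k q) = qDivisionRing.y k q ∧
        h₂ (qDivisionRing.x k q) = qDivisionRing.x k q ∧
        (h₂ (qDivisionRing.y k q) : QLaurent k q) = (1 + QLaurent.x) * QLaurent.y ∧
        (h₃ (qDivisionRing.x k q) : QLaurent k q) = (1 + QLaurent.y)⁻¹ * QLaurent.x ∧
        h₃ (qDivisionRing.y k q) = qDivisionRing.y k q ∧
        ∀ r : qDivisionRing k q, θ r = h₃ (h₂ (h₁ r))) ∧
    -- (ii)
    (∃ (z : QLaurent k q) (θ : qDivisionRing k q →ₐ[k] qDivisionRing k q),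
      IsConjugationBy θ z ∧ ¬ Function.Surjective θ) :=
  ⟨qDivisionRing.exists_conjugation_sq_mem hq, qDivisionRing.exists_conjugation_no_power_mem hq,
    qDivisionRing.exists_conjugation_not_surjective hq⟩
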